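/- Let $\alpha,\beta,\gamma$ be a basis of the real left-invariant 1-forms on $SU(2)$ with $d\alpha=-\beta\wedge\gamma$, $d\beta=-\gamma\wedge\alpha$, $d\gamma=-\alpha\wedge\beta$. Let $r_1,r_2,s_1,s_2\in\mathbb C$ with $r_1s_2-r_2s_1=1$ and put $$\theta=\gamma,\quad Z^1=r_1\beta+r_2\alpha,\quad Z^2=s_1\beta+s_2\alpha,\qquad x=r_1s_1+r_2s_2,\quad y=-(r_1^2+r_2^2),\quad z=s_1^2+s_2^2 .$$ (1) The complex lines $T^1=\ker\theta\cap\ker Z^2$ and $T^2=\ker\theta\cap\ker Z^1$ in $T\,SU(2)\otimes\mathbb C$ form a flag structure: they are smooth line sub-bundles, $T^1\cap T^2=0$, and $T^1\oplus T^2=\ker\theta$ is a contact distribution. Moreover $d\theta=Z^1\wedge Z^2$. (2) Let $Y=SU(2)\times\{(a_1,a_2,v_1,v_2,s)\in(\mathbb C^*)^2\times\mathbb C^3\}$ be the coframe bundle of this flag structure, with tautological forms ($\lambda=a_1a_2$) $$\omega=\lambda\theta,\quad \omega^1=a_1Z^1+v_1\lambda\theta,\quad \omega^2=a_2Z^2+v_2\lambda\theta,\quad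 \varphi=-\tfrac{d\lambda}{\lambda}+a_1v_2Z^1-a_2v_1Z^2+s\,\theta .$$ There are unique smooth complex 1-forms $\omega^1_1,\varphi^1,\varphi^2,\psi$ and functions $Q^1,Q^2,U_1,U_2$ on $Y$ such that $$d\omega=\omega\wedge\varphi+\omega^1\wedge\omega^2,\qquad d\omega^1=\tfrac12\omega^1\wedge\varphi+\omega^1\wedge\omega^1_1+\omega\wedge\varphi^1,\qquad d\omega^2=\tfrac12\omega^2\wedge\varphi-\omega^2\wedge\omega^1_1+\omega\wedge\varphi^2,$$ $$d\varphi=\omega^1\wedge\varphi^2-\omega^2\wedge\varphi^1+\omega\wedge\psi,\qquad d\omega_1^1=\tfrac32\omega^2\wedge\varphi^1+\tfrac32\omega^1\wedge\varphi^2,$$ $$d\varphi^1-\varphi^1\wedge\omega^1_1-\tfrac12\omega^1\wedge\psi-\tfrac12\varphi\wedge\varphi^1=Q^1\,\omega\wedge\omega^2,\qquad d\varphi^2+\varphi^2\wedge\omega^1_1-\tfrac12\omega^2\wedge\psi-\tfrac12\varphi\wedge\varphi^2=Q^2\,\omega\wedge\omega^1,$$ $$d\psi-2\varphi^1\wedge\varphi^2-\varphi\wedge\psi=(U_1\omega^1+U_2\omega^2)\wedge\omega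 .$$ (3) Let $X=SU(2)\times\mathbb C^*$ be the bundle of coframes $(\theta,aZ^1,a^{-1}Z^2)$, embedded in $Y$ by $(g,a)\mapsto(g,a,a^{-1},0,0,0)$. For a smooth section $\sigma$ of $Y$ one has $\sigma^*\omega=\theta$ and $\sigma^*\varphi=0$ if and only if $\sigma$ takes its values in $X$; then $\sigma^*\omega^1=aZ^1$ and $\sigma^*\omega^2=a^{-1}Z^2$, where $a:SU(2)\to\mathbb C^*$ is the fibre coordinate of $\sigma$. At the point $(g,a)$ of $X$, $$Q^1=-\tfrac32\,xy\,a^2,\qquad Q^2=\tfrac32\,xz\,a^{-2}.$$ For every point $p\in Y$, $Q^1(p)=Q^2(p)=0$ if and only if $x=0$ or $y=z=0$; in particular $Q^1$ and $Q^2$ both vanish identically if and only if $x=0$ or $y=z=0$. (4) Let $$\pi=\begin{pmatrix}-\frac12\varphi-\frac13\omega^1_1&-\varphi^2&-\frac14\psi\\ \omega^1&\frac23\omega^1_1&\frac12\varphi^1\\ 2\omega&2\omega^2&\frac12\varphi-\frac13\omega^1_1\end{pmatrix},\qquad TC_2(\pi)=\frac1{24\pi^2}\operatorname{tr}(\pi\wedge\pi\wedge\pi).$$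 For every section $s$ of $X$ with constant $a$, $$s^*TC_2(\pi)=-\frac1{8\pi^2}\Bigl(2yz+\frac{x^2}2\Bigr)\gamma\wedge\beta\wedge\alpha ,$$ and for the section of $X$ given by an arbitrary smooth function $a:SU(2)\to\mathbb C^*$, $$s^*TC_2(\pi)=-\frac1{8\pi^2}\Bigl(2yz+\frac{x^2}2\Bigr)\gamma\wedge\beta\wedge\alpha-\frac{x}{16\pi^2}\,\frac{da}{a}\wedge\beta\wedge\alpha .$$ -/

import Mathlib

open scoped Matrix TensorProduct Topology

noncomputable section

/-! ### The group SU(2), its Lie algebra and its exponential map -/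

/-- The Lie group `SU(2)`. -/
abbrev SU2 : Type := Matrix.specialUnitaryGroup (Fin 2) ℂ

/-- The Lie algebra `su(2)`: skew-Hermitian matrices of trace zero. -/
def su2 : Submodule ℝ (Matrix (Fin 2) (Fin 2) ℂ) where
  carrier := {A | Aᴴ = -A ∧ A.trace = 0}
  zero_mem' := by simp
  add_mem' := by
    rintro A B ⟨hA, hA'⟩ ⟨hB, hB'⟩
    refine ⟨?_, ?_⟩
    · rw [Matrix.conjTranspose_add, hA, hB, neg_add]
    · rw [Matrix.trace_add, hA', hB', add_zero]
  smul_mem' := by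
    rintro c A ⟨hA, hA'⟩
    refine ⟨?_, ?_⟩
    · rw [Matrix.conjTranspose_smul, hA, star_trivial, smul_neg]
    · rw [Matrix.trace_smul, hA', smul_zero]

/-- The Lie bracket `[A, B] = A B - B A` of `su(2)`. -/
def su2Bracket (A B : su2) : su2 :=
  ⟨A.1 * B.1 - B.1 * A.1, by
    have hA := A.2.1
    have hB := B.2.1
    refine ⟨?_, ?_⟩
    · rw [Matrix.conjTranspose_sub, Matrix.conjTranspose_mul, Matrix.conjTranspose_mul, hA, hB]
      simp
    · rw [Matrix.trace_sub, Matrix.trace_mul_comm A.1 B.1, sub_self]⟩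

theorem exp_mem_SU2 (A : su2) :
    NormedSpace.exp (A : Matrix (Fin 2) (Fin 2) ℂ) ∈ Matrix.specialUnitaryGroup (Fin 2) ℂ := by
  have hA : (A : Matrix (Fin 2) (Fin 2) ℂ)ᴴ = -A := A.2.1
  have hA' : (A : Matrix (Fin 2) (Fin 2) ℂ).trace = 0 := A.2.2
  generalize (A : Matrix (Fin 2) (Fin 2) ℂ) = A at hA hA' ⊢
  have hdet : IsUnit (NormedSpace.exp A).det :=
    (Matrix.isUnit_iff_isUnit_det _).1 (Matrix.isUnit_exp A)
  rw [Matrix.mem_specialUnitaryGroup_iff]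
  refine ⟨?_, ?_⟩
  · rw [Matrix.mem_unitaryGroup_iff, Matrix.star_eq_conjTranspose, ← Matrix.exp_conjTranspose, hA,
      Matrix.exp_neg, Matrix.mul_nonsing_inv _ hdet]
  · -- for 2 × 2 matrices the adjugate is conjugate to the transpose
    let J : Matrix (Fin 2) (Fin 2) ℂ := !![0, 1; -1, 0]
    have hJ : IsUnit J := by
      rw [Matrix.isUnit_iff_isUnit_det]
      simp [J, Matrix.det_fin_two]
    have hJdet : IsUnit J.det := (Matrix.isUnit_iff_isUnit_det _).1 hJ
    have hadj : ∀ M : Matrix (Fin 2) (Fin 2) ℂ, J * Mᵀ = M.adjugate * J := by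
      intro M
      ext i j
      fin_cases i <;> fin_cases j <;>
        simp [J, Matrix.mul_apply, Fin.sum_univ_two, Matrix.adjugate_fin_two]
    have hconj : ∀ M : Matrix (Fin 2) (Fin 2) ℂ, J * Mᵀ * J⁻¹ = M.adjugate := by
      intro M
      rw [hadj, Matrix.mul_assoc, Matrix.mul_nonsing_inv _ hJdet, Matrix.mul_one]
    have htr : A.adjugate = -A := by
      have h : A 0 0 + A 1 1 = 0 := by simpa [Matrix.trace, Fin.sum_univ_two] using hA'
      ext i j
      fin_cases i <;> fin_cases j <;> simp [Matrix.adjugate_fin_two]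
      · exact eq_neg_of_add_eq_zero_right h
      · exact eq_neg_of_add_eq_zero_left h
    have h1 : (NormedSpace.exp A).adjugate = NormedSpace.exp (-A) := by
      rw [← hconj, ← Matrix.exp_transpose, ← Matrix.exp_conj J _ hJ, hconj, htr]
    have h2 := Matrix.mul_adjugate (NormedSpace.exp A)
    rw [h1, Matrix.exp_neg, Matrix.mul_nonsing_inv _ hdet] at h2
    have h3 := congrFun (congrFun h2 0) 0
    simpa using h3.symm

/-- The exponential map `su(2) → SU(2)`. -/
def su2Exp (A : su2) : SU2 := ⟨NormedSpace.exp (A : Matrix (Fin 2) (Fin 2) ℂ), exp_mem_SU2 A⟩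

/-! ### Differential forms in a left-invariant frame

All manifolds below are Lie groups. Their tangent bundle is trivialised by left translations, so
that a tangent vector at `p` is an element of the Lie algebra `V`, and `X : V` stands for the
left-invariant vector field with flow `p ↦ p · exp (t X)`. -/

/-- `move p X` is `p · exp X`, and `bracket` is the Lie bracket of left-invariant vector fields. -/
class LieFrame (P : Type) (V : outParam Type) where
  move : P → V → P
  bracket : V → V → V

instance : LieFrame SU2 su2 where
  move g A := g * su2Exp A
  bracket := su2Bracket

section Forms

variable {P V : Type} [AddCommGroup V] [Module ℝ V]

variable (P V) in
/-- Complex valued 1-forms, i.e. sections of `T*P ⊗ ℂ`. -/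
abbrev OneForm : Type := P → V →ₗ[ℝ] ℂ

variable (P V) in
/-- Complex valued 2-forms, given by their values on pairs of tangent vectors. -/
abbrev TwoForm : Type := P → V → V → ℂ

variable (P V) in
/-- Complex valued 3-forms, given by their values on triples of tangent vectors. -/
abbrev ThreeForm : Type := P → V → V → V → ℂ

/-- `η ∧ ξ`. -/
def wedge (η ξ : OneForm P V) : TwoForm P V := fun p X Y => η p X * ξ p Y - η p Y * ξ p X

/-- `Θ ∧ ξ` for a 2-form `Θ` and a 1-form `ξ`. -/
def wedge21 (Θ : TwoForm P V) (ξ : OneForm P V) : ThreeForm P V := fun p X Y Z =>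
  Θ p X Y * ξ p Z - Θ p X Z * ξ p Y + Θ p Y Z * ξ p X

/-- `η ∧ ξ ∧ ζ`. -/
def wedge3 (η ξ ζ : OneForm P V) : ThreeForm P V := wedge21 (wedge η ξ) ζ

end Forms

section Calculus

variable {P V : Type} [AddCommGroup V] [Module ℝ V] [LieFrame P V]

/-- Smoothness of a complex function, read in exponential coordinates
`(t₁, …, tₙ) ↦ p · exp (t₁ e₁ + ⋯ + tₙ eₙ)` around each point `p`. -/
def Smooth (f : P → ℂ) : Prop :=
  ∀ (p : P) (n : ℕ) (e : Fin n → V),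
    ContDiffAt ℝ ((⊤ : ℕ∞) : WithTop ℕ∞) (fun t : Fin n → ℝ => f (LieFrame.move p (∑ i, t i • e i))) 0

/-- The derivative `(X f)(p) = d/dt f (p · exp (t X))` at `t = 0`. -/
def dirDeriv (f : P → ℂ) (p : P) (X : V) : ℂ :=
  deriv (fun t : ℝ => f (LieFrame.move p (t • X))) 0

/-- A 1-form is smooth if its coefficients in the frame are. -/
def SmoothForm (η : OneForm P V) : Prop := ∀ X : V, Smooth (fun p => η p X)

/-- The exterior derivative `dη (X, Y) = X (η Y) - Y (η X) - η [X, Y]`. -/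
def extD (η : OneForm P V) : TwoForm P V := fun p X Y =>
  dirDeriv (fun q => η q Y) p X - dirDeriv (fun q => η q X) p Y - η p (LieFrame.bracket (P := P) X Y)

end Calculus

/-- A form on `SU(2)` is left-invariant if its coefficients in the left-invariant frame are
constant, that is, if it is preserved by the pull-back along every left translation. -/
def IsLeftInvariant (η : OneForm SU2 su2) : Prop := ∀ h g : SU2, η (h * g) = η g

/-- The real vector space of (real valued) left-invariant 1-forms on `SU(2)`. -/
def realLeftInvariantForms : Submodule ℝ (OneForm SU2 su2) where
  carrier := {η | IsLeftInvariant η ∧ ∀ g X, (η g X).im = 0}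
  zero_mem' := ⟨fun _ _ => rfl, fun _ _ => rfl⟩
  add_mem' := by
    rintro η ξ ⟨h1, h2⟩ ⟨k1, k2⟩
    exact ⟨fun h g => by simp [h1 h g, k1 h g], fun g X => by simp [h2 g X, k2 g X]⟩
  smul_mem' := by
    rintro c η ⟨h1, h2⟩
    exact ⟨fun h g => by simp [h1 h g], fun g X => by simp [h2 g X]⟩

/-! ### Flag structures -/

/-- The complexified tangent space of `SU(2)` (in the left trivialisation). -/
abbrev su2C : Type := ℂ ⊗[ℝ] su2

/-- The kernel, in the complexified tangent space, of the complex linear extension of a covector. -/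
def kerC (η : su2 →ₗ[ℝ] ℂ) : Submodule ℂ su2C := LinearMap.ker (η.liftBaseChange ℂ)

/-- A smooth complex line sub-bundle of the complexified tangent bundle: each fibre is a line, and
locally the bundle is the common kernel of two smooth 1-forms. -/
structure IsLineBundle (T : SU2 → Submodule ℂ su2C) : Prop where
  finrank_eq : ∀ g, Module.finrank ℂ (T g) = 1
  smooth : ∀ g₀, ∃ η ξ : OneForm SU2 su2, SmoothForm η ∧ SmoothForm ξ ∧
    ∀ᶠ g in 𝓝 g₀, T g = kerC (η g) ⊓ kerC (ξ g)

/-- A flag structure on `SU(2)`: two complex line sub-bundles of the complexified tangent bundle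
which intersect trivially and whose sum is a contact distribution. -/
structure IsFlagStructure (T₁ T₂ : SU2 → Submodule ℂ su2C) : Prop where
  line₁ : IsLineBundle T₁
  line₂ : IsLineBundle T₂
  disjoint : ∀ g, T₁ g ⊓ T₂ g = ⊥
  contact : ∀ g₀, ∃ θ : OneForm SU2 su2, SmoothForm θ ∧
    ∀ᶠ g in 𝓝 g₀, kerC (θ g) = T₁ g ⊔ T₂ g ∧ wedge21 (extD θ) θ g ≠ 0

/-! ### The coframe bundle `Y` -/

/-- The coframe bundle `Y → SU(2)` of a flag structure, in the trivialisation given by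
1-forms `θ, θ¹, θ²` on `SU(2)` with `dθ = θ¹ ∧ θ²`, `ker θ = T₁ ⊕ T₂`, `θ¹ (T₂) = 0 = θ² (T₁)`.
The point `(g, a₁, a₂, v₁, v₂, s)` is the coframe, at the point `λ θ`, `λ = a₁ a₂`, of the
`ℂˣ`-bundle of contact forms over `g`, that consists of
`ω = λ θ`, `ω¹ = a₁ θ¹ + v₁ λ θ`, `ω² = a₂ θ² + v₂ λ θ`,
`φ = - dλ / λ + a₁ v₂ θ¹ - a₂ v₁ θ² + s θ`. -/
@[ext] structure CoframeBundle where
  g : SU2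
  a₁ : ℂˣ
  a₂ : ℂˣ
  v₁ : ℂ
  v₂ : ℂ
  s : ℂ

/-- Tangent vectors of `Y`: an element of `su(2)` and the components
`(da₁ / a₁, da₂ / a₂, dv₁, dv₂, ds)`. -/
abbrev CoframeTangent : Type := su2 × ℂ × ℂ × ℂ × ℂ × ℂ

/-- `exp z` as a nonzero complex number. -/
def cexpUnit (z : ℂ) : ℂˣ := Units.mk0 (Complex.exp z) (Complex.exp_ne_zero z)

/-- `Y` as the Lie group `SU(2) × ℂˣ × ℂˣ × ℂ³`. -/
instance : LieFrame CoframeBundle CoframeTangent where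
  move p X := ⟨p.g * su2Exp X.1, p.a₁ * cexpUnit X.2.1, p.a₂ * cexpUnit X.2.2.1,
    p.v₁ + X.2.2.2.1, p.v₂ + X.2.2.2.2.1, p.s + X.2.2.2.2.2⟩
  bracket X X' := (su2Bracket X.1 X'.1, 0, 0, 0, 0, 0)

namespace CoframeBundle

/-- Pull-back of a 1-form on `SU(2)` to `Y`. -/
def lift (η : OneForm SU2 su2) : OneForm CoframeBundle CoframeTangent :=
  fun p => (η p.g).comp (LinearMap.fst ℝ su2 (ℂ × ℂ × ℂ × ℂ × ℂ))

/-- The function `λ = a₁ a₂`. -/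
def scale (p : CoframeBundle) : ℂ := p.a₁ * p.a₂

/-- The form `dλ / λ = da₁ / a₁ + da₂ / a₂`. -/
def dlogScale : OneForm CoframeBundle CoframeTangent := fun _ =>
  { toFun := fun X => X.2.1 + X.2.2.1
    map_add' := fun X X' => by simp only [Prod.snd_add, Prod.fst_add]; ring
    map_smul' := fun c X => by simp }

/-- The tautological form `ω`. -/
def ω (θ : OneForm SU2 su2) : OneForm CoframeBundle CoframeTangent :=
  fun p => p.scale • lift θ p

/-- The tautological form `ω¹`. -/
def ω₁ (θ θ₁ : OneForm SU2 su2) : OneForm CoframeBundle CoframeTangent :=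
  fun p => (p.a₁ : ℂ) • lift θ₁ p + (p.v₁ * p.scale) • lift θ p

/-- The tautological form `ω²`. -/
def ω₂ (θ θ₂ : OneForm SU2 su2) : OneForm CoframeBundle CoframeTangent :=
  fun p => (p.a₂ : ℂ) • lift θ₂ p + (p.v₂ * p.scale) • lift θ p

/-- The tautological form `φ`. -/
def φ (θ θ₁ θ₂ : OneForm SU2 su2) : OneForm CoframeBundle CoframeTangent :=
  fun p => -dlogScale p + (p.a₁ * p.v₂ : ℂ) • lift θ₁ p - (p.a₂ * p.v₁ : ℂ) • lift θ₂ p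
    + p.s • lift θ p

end CoframeBundle

/-! ### The adapted connection and its curvatures -/

/-- The forms `ω₁¹, φ¹, φ², ψ` completing the tautological forms to a connection on `Y`, together
with the curvature functions `Q¹, Q², U₁, U₂`. -/
structure ConnectionData where
  ω₁₁ : OneForm CoframeBundle CoframeTangent
  φ₁ : OneForm CoframeBundle CoframeTangent
  φ₂ : OneForm CoframeBundle CoframeTangent
  ψ : OneForm CoframeBundle CoframeTangent
  Q₁ : CoframeBundle → ℂ
  Q₂ : CoframeBundle → ℂ
  U₁ : CoframeBundle → ℂ
  U₂ : CoframeBundle → ℂ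

namespace ConnectionData

/-- `C` is the adapted connection, with its curvature functions, of the flag structure given by
the coframe `θ, θ¹, θ²`: the forms are smooth and satisfy the structure equations. -/
structure IsAdapted (θ θ₁ θ₂ : OneForm SU2 su2) (C : ConnectionData) : Prop where
  smooth_ω₁₁ : SmoothForm C.ω₁₁
  smooth_φ₁ : SmoothForm C.φ₁
  smooth_φ₂ : SmoothForm C.φ₂
  smooth_ψ : SmoothForm C.ψ
  /-- `dω = ω ∧ φ + ω¹ ∧ ω²` -/
  d_ω : extD (CoframeBundle.ω θ) =
    wedge (CoframeBundle.ω θ) (CoframeBundle.φ θ θ₁ θ₂)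
      + wedge (CoframeBundle.ω₁ θ θ₁) (CoframeBundle.ω₂ θ θ₂)
  /-- `dω¹ = ½ ω¹ ∧ φ + ω¹ ∧ ω₁¹ + ω ∧ φ¹` -/
  d_ω₁ : extD (CoframeBundle.ω₁ θ θ₁) =
    (1 / 2 : ℂ) • wedge (CoframeBundle.ω₁ θ θ₁) (CoframeBundle.φ θ θ₁ θ₂)
      + wedge (CoframeBundle.ω₁ θ θ₁) C.ω₁₁ + wedge (CoframeBundle.ω θ) C.φ₁
  /-- `dω² = ½ ω² ∧ φ - ω² ∧ ω₁¹ + ω ∧ φ²` -/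
  d_ω₂ : extD (CoframeBundle.ω₂ θ θ₂) =
    (1 / 2 : ℂ) • wedge (CoframeBundle.ω₂ θ θ₂) (CoframeBundle.φ θ θ₁ θ₂)
      - wedge (CoframeBundle.ω₂ θ θ₂) C.ω₁₁ + wedge (CoframeBundle.ω θ) C.φ₂
  /-- `dφ = ω¹ ∧ φ² - ω² ∧ φ¹ + ω ∧ ψ` -/
  d_φ : extD (CoframeBundle.φ θ θ₁ θ₂) =
    wedge (CoframeBundle.ω₁ θ θ₁) C.φ₂ - wedge (CoframeBundle.ω₂ θ θ₂) C.φ₁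
      + wedge (CoframeBundle.ω θ) C.ψ
  /-- `dω₁¹ - (3/2) ω² ∧ φ¹ - (3/2) ω¹ ∧ φ² = 0` -/
  curv_Ω₁₁ : extD C.ω₁₁ - (3 / 2 : ℂ) • wedge (CoframeBundle.ω₂ θ θ₂) C.φ₁
      - (3 / 2 : ℂ) • wedge (CoframeBundle.ω₁ θ θ₁) C.φ₂ = 0
  /-- `dφ¹ - φ¹ ∧ ω₁¹ - ½ ω¹ ∧ ψ - ½ φ ∧ φ¹ = Q¹ ω ∧ ω²` -/
  curv_Φ₁ : extD C.φ₁ - wedge C.φ₁ C.ω₁₁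
      - (1 / 2 : ℂ) • wedge (CoframeBundle.ω₁ θ θ₁) C.ψ
      - (1 / 2 : ℂ) • wedge (CoframeBundle.φ θ θ₁ θ₂) C.φ₁ =
    fun p => C.Q₁ p • wedge (CoframeBundle.ω θ) (CoframeBundle.ω₂ θ θ₂) p
  /-- `dφ² + φ² ∧ ω₁¹ - ½ ω² ∧ ψ - ½ φ ∧ φ² = Q² ω ∧ ω¹` -/
  curv_Φ₂ : extD C.φ₂ + wedge C.φ₂ C.ω₁₁
      - (1 / 2 : ℂ) • wedge (CoframeBundle.ω₂ θ θ₂) C.ψ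
      - (1 / 2 : ℂ) • wedge (CoframeBundle.φ θ θ₁ θ₂) C.φ₂ =
    fun p => C.Q₂ p • wedge (CoframeBundle.ω θ) (CoframeBundle.ω₁ θ θ₁) p
  /-- `dψ - 2 φ¹ ∧ φ² - φ ∧ ψ = (U₁ ω¹ + U₂ ω²) ∧ ω` -/
  curv_Ψ : extD C.ψ - (2 : ℂ) • wedge C.φ₁ C.φ₂
      - wedge (CoframeBundle.φ θ θ₁ θ₂) C.ψ =
    fun p => C.U₁ p • wedge (CoframeBundle.ω₁ θ θ₁) (CoframeBundle.ω θ) p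
      + C.U₂ p • wedge (CoframeBundle.ω₂ θ θ₂) (CoframeBundle.ω θ) p

/-- The `sl(3, ℂ)`-valued connection form `π` on `Y`. -/
def connectionForm (θ θ₁ θ₂ : OneForm SU2 su2) (C : ConnectionData) :
    Matrix (Fin 3) (Fin 3) (OneForm CoframeBundle CoframeTangent) :=
  let ω := CoframeBundle.ω θ
  let ω₁ := CoframeBundle.ω₁ θ θ₁
  let ω₂ := CoframeBundle.ω₂ θ θ₂
  let φ := CoframeBundle.φ θ θ₁ θ₂
  !![-(1 / 2 : ℂ) • φ - (1 / 3 : ℂ) • C.ω₁₁, -C.φ₂, -(1 / 4 : ℂ) • C.ψ;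
     ω₁, (2 / 3 : ℂ) • C.ω₁₁, (1 / 2 : ℂ) • C.φ₁;
     (2 : ℂ) • ω, (2 : ℂ) • ω₂, (1 / 2 : ℂ) • φ - (1 / 3 : ℂ) • C.ω₁₁]

/-- The Chern–Simons form `TC₂(π) = (1 / 24π²) tr (π ∧ π ∧ π)` on `Y`. -/
def chernSimons (θ θ₁ θ₂ : OneForm SU2 su2) (C : ConnectionData) :
    ThreeForm CoframeBundle CoframeTangent :=
  let π := connectionForm θ θ₁ θ₂ C
  (1 / (24 * (Real.pi : ℂ) ^ 2)) • ∑ i, ∑ j, ∑ k, wedge3 (π i j) (π j k) (π k i)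

end ConnectionData

/-! ### Sections of `Y` -/

/-- A section `SU(2) → Y`, given by its fibre coordinates. -/
@[ext] structure CoframeSection where
  a₁ : SU2 → ℂˣ
  a₂ : SU2 → ℂˣ
  v₁ : SU2 → ℂ
  v₂ : SU2 → ℂ
  s : SU2 → ℂ

namespace CoframeSection

/-- The section is smooth. -/
structure IsSmooth (σ : CoframeSection) : Prop where
  a₁ : Smooth (fun g => (σ.a₁ g : ℂ))
  a₂ : Smooth (fun g => (σ.a₂ g : ℂ))
  v₁ : Smooth σ.v₁
  v₂ : Smooth σ.v₂
  s : Smooth σ.s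

/-- The underlying map `SU(2) → Y`. -/
def toFun (σ : CoframeSection) (g : SU2) : CoframeBundle :=
  ⟨g, σ.a₁ g, σ.a₂ g, σ.v₁ g, σ.v₂ g, σ.s g⟩

/-- The logarithmic derivative `da / a`. -/
def dlog (a : SU2 → ℂˣ) (g : SU2) (X : su2) : ℂ :=
  dirDeriv (fun h => (a h : ℂ)) g X / (a g : ℂ)

/-- The differential of a section. -/
def tangent (σ : CoframeSection) (g : SU2) (X : su2) : CoframeTangent :=
  (X, dlog σ.a₁ g X, dlog σ.a₂ g X, dirDeriv σ.v₁ g X, dirDeriv σ.v₂ g X, dirDeriv σ.s g X)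

/-- Pull-back of a 1-form along a section, by its values on tangent vectors. -/
def pullback₁ (σ : CoframeSection) (η : OneForm CoframeBundle CoframeTangent) :
    SU2 → su2 → ℂ :=
  fun g X => η (σ.toFun g) (σ.tangent g X)

/-- Pull-back of a 3-form along a section. -/
def pullback₃ (σ : CoframeSection) (Θ : ThreeForm CoframeBundle CoframeTangent) :
    ThreeForm SU2 su2 :=
  fun g X Y Z => Θ (σ.toFun g) (σ.tangent g X) (σ.tangent g Y) (σ.tangent g Z)

/-- The section of `Y` obtained from the section `(θ, a θ¹, a⁻¹ θ²)` of the `ℂˣ`-coframe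
bundle `X` of the contact form `θ`. -/
def ofX (a : SU2 → ℂˣ) : CoframeSection where
  a₁ := a
  a₂ := fun g => (a g)⁻¹
  v₁ := 0
  v₂ := 0
  s := 0

end CoframeSection

/-- The embedding `X → Y`: the point `(g, a)` of `X` is the coframe `(θ, a θ¹, a⁻¹ θ²)` at `g`. -/
def embX (g : SU2) (a : ℂˣ) : CoframeBundle := ⟨g, a, a⁻¹, 0, 0, 0⟩

end

/-! The coframe θ, Z¹, Z² is left-invariant, with dθ = Z¹∧Z², dZ¹ = θ∧(xZ¹ + yZ²), dZ² = θ∧(zZ¹ −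
xZ²) (`isFlagCoframe_of_basis`), so x, y, z are its only structure constants. On Y, in the frame θ,
Z¹, Z², da₁/a₁, da₂/a₂, dv₁, dv₂, ds, all the forms have coefficients polynomial in v₁, v₂, s and
a₁, a₂ and their inverses. `extD_frameForm` differentiates such forms, and existence becomes a list
of algebraic identities for the explicit connection `ofCoframe`.

Uniqueness (`IsAdapted.unique`) compares two solutions. The equations for dω¹ and dω² fix ω¹₁ up to
a multiple of ω, and the equation for dω¹₁ removes that multiple because ω is a contact form
(`IsAdapted.ω₁₁_unique`). Then φ¹ and φ² are fixed up to multiples of ω, which dω¹₁ again removes.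
Next, dφ fixes ψ up to a multiple of ω, and the missing ω∧ω¹ term in the equation for dφ¹ removes
it. The curvature functions are then components of known 2-forms.

For a section, σ*ω = θ means λ = 1, hence dλ = 0, and σ*φ = 0 then says v₁ = v₂ = s = 0
(`pullback_ω_φ_iff`). The curvatures are read off from `ofCoframe`: Q¹ and Q² are xy and xz times
functions without zeros. Pulling π back to X expresses tr(π∧π∧π) through θ, Z¹, Z² and da/a
(`pullback_chernSimons`). -/

noncomputable section

/-! ### Directional derivatives in a left-invariant frame -/

section Calculus

variable {P V : Type} [AddCommGroup V] [Module ℝ V] [LieFrame P V]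

/-- `f' p X` is the derivative of `t ↦ f (p · exp (t X))` at `t = 0`, and the curve starts at `p`. -/
def HasDirDeriv (f : P → ℂ) (f' : P → V → ℂ) : Prop :=
  ∀ p X, HasDerivAt (fun t : ℝ => f (LieFrame.move p (t • X))) (f' p X) 0 ∧
    f (LieFrame.move p ((0 : ℝ) • X)) = f p

namespace HasDirDeriv

variable {f g : P → ℂ} {f' g' : P → V → ℂ}

theorem dirDeriv_eq (h : HasDirDeriv f f') (p : P) (X : V) : dirDeriv f p X = f' p X :=
  (h p X).1.deriv

theorem const (c : ℂ) : HasDirDeriv (fun _ : P => c) (fun _ _ => 0) :=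
  fun _ _ => ⟨hasDerivAt_const _ _, rfl⟩

theorem add (hf : HasDirDeriv f f') (hg : HasDirDeriv g g') :
    HasDirDeriv (fun p => f p + g p) (fun p X => f' p X + g' p X) :=
  fun p X => ⟨(hf p X).1.add (hg p X).1, by simp only [(hf p X).2, (hg p X).2]⟩

theorem sub (hf : HasDirDeriv f f') (hg : HasDirDeriv g g') :
    HasDirDeriv (fun p => f p - g p) (fun p X => f' p X - g' p X) :=
  fun p X => ⟨(hf p X).1.sub (hg p X).1, by simp only [(hf p X).2, (hg p X).2]⟩

theorem neg (hf : HasDirDeriv f f') : HasDirDeriv (fun p => -f p) (fun p X => -f' p X) :=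
  fun p X => ⟨(hf p X).1.neg, by simp only [(hf p X).2]⟩

theorem mul (hf : HasDirDeriv f f') (hg : HasDirDeriv g g') :
    HasDirDeriv (fun p => f p * g p) (fun p X => f' p X * g p + f p * g' p X) :=
  fun p X => ⟨by
      have h := (hf p X).1.mul (hg p X).1
      -- The product rule evaluates the factors at the point p · exp(0 · X); the second clause of
      -- `HasDirDeriv` turns this into p.
      rw [(hf p X).2, (hg p X).2] at h
      exact h,
    by simp only [(hf p X).2, (hg p X).2]⟩

end HasDirDeriv

theorem Smooth.const (c : ℂ) : Smooth (fun _ : P => c) := fun _ _ _ => contDiffAt_const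

theorem Smooth.add {f g : P → ℂ} (hf : Smooth f) (hg : Smooth g) : Smooth (fun p => f p + g p) :=
  fun p n e => (hf p n e).add (hg p n e)

theorem Smooth.sub {f g : P → ℂ} (hf : Smooth f) (hg : Smooth g) : Smooth (fun p => f p - g p) :=
  fun p n e => (hf p n e).sub (hg p n e)

theorem Smooth.neg {f : P → ℂ} (hf : Smooth f) : Smooth (fun p => -f p) :=
  fun p n e => (hf p n e).neg

theorem Smooth.mul {f g : P → ℂ} (hf : Smooth f) (hg : Smooth g) : Smooth (fun p => f p * g p) :=
  fun p n e => (hf p n e).mul (hg p n e)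

/-- The derivative of a smooth function along a curve `t ↦ p · exp (t X)` exists. -/
theorem Smooth.differentiableAt {f : P → ℂ} (hf : Smooth f) (p : P) (X : V) :
    DifferentiableAt ℝ (fun t : ℝ => f (LieFrame.move p (t • X))) 0 := by
  have h := (hf p 1 ![X]).differentiableAt (by simp)
  have h2 : DifferentiableAt ℝ (fun t : ℝ => (fun _ : Fin 1 => t)) 0 := by fun_prop
  have h3 := DifferentiableAt.comp (0 : ℝ) (g := fun t : Fin 1 → ℝ =>
    f (LieFrame.move p (∑ i, t i • ![X] i))) h h2
  simpa [Function.comp_def] using h3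

/-- The derivative of a smooth function depends linearly on the direction. -/
theorem Smooth.exists_dirDeriv_eq {f : P → ℂ} (hf : Smooth f) (p : P) :
    ∃ L : V →ₗ[ℝ] ℂ, ∀ X, L X = dirDeriv f p X := by
  -- `Smooth` admits every finite family e, independent or not, so any pair X, Y can serve as e, and
  -- the derivative along ∑ cᵢ eᵢ is one Fréchet derivative applied to c.
  have key : ∀ (n : ℕ) (e : Fin n → V) (c : Fin n → ℝ),
      dirDeriv f p (∑ i, c i • e i) = fderiv ℝ
        (fun t : Fin n → ℝ => f (LieFrame.move p (∑ i, t i • e i))) 0 c := by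
    intro n e c
    have h := (hf p n e).differentiableAt (by simp)
    have h2 : HasDerivAt (fun t : ℝ => t • c) c 0 := by
      simpa using (hasDerivAt_id (0 : ℝ)).smul_const c
    have h3 := HasFDerivAt.comp_hasDerivAt (0 : ℝ) (l := fun t : Fin n → ℝ =>
      f (LieFrame.move p (∑ i, t i • e i))) (by simpa using h.hasFDerivAt) h2
    have h4 := h3.deriv
    simpa [dirDeriv, Function.comp_def, Finset.smul_sum, smul_smul] using h4
  refine ⟨⟨⟨dirDeriv f p, fun X Y => ?_⟩, fun c X => ?_⟩, fun _ => rfl⟩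
  · have h1 := key 2 ![X, Y] ![1, 1]
    have h2 := key 2 ![X, Y] ![1, 0]
    have h3 := key 2 ![X, Y] ![0, 1]
    simp only [Fin.sum_univ_two, Matrix.cons_val_zero, Matrix.cons_val_one, one_smul, zero_smul,
      add_zero, zero_add] at h1 h2 h3
    rw [h1, h2, h3, ← map_add]
    simp
  · have h1 := key 1 ![X] ![c]
    have h2 := key 1 ![X] ![1]
    simp only [one_smul, Finset.univ_unique, Fin.default_eq_zero, Finset.sum_singleton,
      Matrix.cons_val_fin_one] at h1 h2
    simp only [RingHom.id_apply]
    rw [h1, h2, ← map_smul]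
    simp

end Calculus

/-! ### Derivatives and smoothness of the fibre coordinates of Y. -/

namespace CoframeBundle

@[simp] theorem coe_cexpUnit (z : ℂ) : (cexpUnit z : ℂ) = Complex.exp z := rfl

theorem hasDirDeriv_a₁ :
    HasDirDeriv (fun p : CoframeBundle => (p.a₁ : ℂ)) (fun p X => p.a₁ * X.2.1) := by
  intro p X
  refine ⟨?_, by simp [LieFrame.move]⟩
  have h : HasDerivAt (fun t : ℝ => (p.a₁ : ℂ) * Complex.exp (t * X.2.1))
      (p.a₁ * (Complex.exp ((0 : ℝ) * X.2.1) * (1 * X.2.1))) 0 :=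
    (((Complex.ofRealCLM.hasDerivAt (x := 0)).mul_const X.2.1).cexp).const_mul _
  simpa [LieFrame.move] using h

theorem hasDirDeriv_a₂ :
    HasDirDeriv (fun p : CoframeBundle => (p.a₂ : ℂ)) (fun p X => p.a₂ * X.2.2.1) := by
  intro p X
  refine ⟨?_, by simp [LieFrame.move]⟩
  have h : HasDerivAt (fun t : ℝ => (p.a₂ : ℂ) * Complex.exp (t * X.2.2.1))
      (p.a₂ * (Complex.exp ((0 : ℝ) * X.2.2.1) * (1 * X.2.2.1))) 0 :=
    (((Complex.ofRealCLM.hasDerivAt (x := 0)).mul_const X.2.2.1).cexp).const_mul _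
  simpa [LieFrame.move] using h

/-- The inverses of a₁ and a₂ are treated as further coordinate functions, so that the coefficients
of the connection are built by sums and products alone. -/
theorem hasDirDeriv_inv_a₁ :
    HasDirDeriv (fun p : CoframeBundle => (p.a₁ : ℂ)⁻¹) (fun p X => -((p.a₁ : ℂ)⁻¹ * X.2.1)) := by
  intro p X
  refine ⟨?_, by simp [LieFrame.move]⟩
  have h : HasDerivAt (fun t : ℝ => (p.a₁ : ℂ)⁻¹ * Complex.exp (-(t * X.2.1)))
      ((p.a₁ : ℂ)⁻¹ * (Complex.exp (-((0 : ℝ) * X.2.1)) * -(1 * X.2.1))) 0 :=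
    (((Complex.ofRealCLM.hasDerivAt (x := 0)).mul_const X.2.1).neg.cexp).const_mul _
  simpa [LieFrame.move, Complex.exp_neg, mul_comm] using h

theorem hasDirDeriv_inv_a₂ :
    HasDirDeriv (fun p : CoframeBundle => (p.a₂ : ℂ)⁻¹)
      (fun p X => -((p.a₂ : ℂ)⁻¹ * X.2.2.1)) := by
  intro p X
  refine ⟨?_, by simp [LieFrame.move]⟩
  have h : HasDerivAt (fun t : ℝ => (p.a₂ : ℂ)⁻¹ * Complex.exp (-(t * X.2.2.1)))
      ((p.a₂ : ℂ)⁻¹ * (Complex.exp (-((0 : ℝ) * X.2.2.1)) * -(1 * X.2.2.1))) 0 :=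
    (((Complex.ofRealCLM.hasDerivAt (x := 0)).mul_const X.2.2.1).neg.cexp).const_mul _
  simpa [LieFrame.move, Complex.exp_neg, mul_comm] using h

theorem hasDirDeriv_v₁ : HasDirDeriv (fun p : CoframeBundle => p.v₁) (fun _ X => X.2.2.2.1) := by
  intro p X
  refine ⟨?_, by simp [LieFrame.move]⟩
  have h : HasDerivAt (fun t : ℝ => p.v₁ + t * X.2.2.2.1) (1 * X.2.2.2.1) 0 :=
    ((Complex.ofRealCLM.hasDerivAt (x := 0)).mul_const X.2.2.2.1).const_add _
  simpa [LieFrame.move] using h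

theorem hasDirDeriv_v₂ :
    HasDirDeriv (fun p : CoframeBundle => p.v₂) (fun _ X => X.2.2.2.2.1) := by
  intro p X
  refine ⟨?_, by simp [LieFrame.move]⟩
  have h : HasDerivAt (fun t : ℝ => p.v₂ + t * X.2.2.2.2.1) (1 * X.2.2.2.2.1) 0 :=
    ((Complex.ofRealCLM.hasDerivAt (x := 0)).mul_const X.2.2.2.2.1).const_add _
  simpa [LieFrame.move] using h

theorem hasDirDeriv_s :
    HasDirDeriv (fun p : CoframeBundle => p.s) (fun _ X => X.2.2.2.2.2) := by
  intro p X
  refine ⟨?_, by simp [LieFrame.move]⟩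
  have h : HasDerivAt (fun t : ℝ => p.s + t * X.2.2.2.2.2) (1 * X.2.2.2.2.2) 0 :=
    ((Complex.ofRealCLM.hasDerivAt (x := 0)).mul_const X.2.2.2.2.2).const_add _
  simpa [LieFrame.move] using h

theorem contDiffAt_sum_ofReal_mul {n : ℕ} (c : Fin n → ℂ) :
    ContDiffAt ℝ ((⊤ : ℕ∞) : WithTop ℕ∞) (fun t : Fin n → ℝ => ∑ i, (t i : ℂ) * c i) 0 :=
  ContDiffAt.sum fun i _ =>
    ((Complex.ofRealCLM.contDiff.comp (contDiff_apply ℝ ℝ i)).mul contDiff_const).contDiffAt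

theorem smooth_a₁ : Smooth (fun p : CoframeBundle => (p.a₁ : ℂ)) := by
  intro p n e
  simp only [LieFrame.move, Units.val_mul, coe_cexpUnit, Prod.snd_sum, Prod.fst_sum, Prod.smul_snd,
    Prod.smul_fst, Complex.real_smul]
  exact contDiffAt_const.mul (contDiffAt_sum_ofReal_mul _).cexp

theorem smooth_a₂ : Smooth (fun p : CoframeBundle => (p.a₂ : ℂ)) := by
  intro p n e
  simp only [LieFrame.move, Units.val_mul, coe_cexpUnit, Prod.snd_sum, Prod.fst_sum, Prod.smul_snd,
    Prod.smul_fst, Complex.real_smul]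
  exact contDiffAt_const.mul (contDiffAt_sum_ofReal_mul _).cexp

theorem smooth_inv_a₁ : Smooth (fun p : CoframeBundle => (p.a₁ : ℂ)⁻¹) :=
  fun p n e => (smooth_a₁ p n e).inv (Units.ne_zero _)

theorem smooth_inv_a₂ : Smooth (fun p : CoframeBundle => (p.a₂ : ℂ)⁻¹) :=
  fun p n e => (smooth_a₂ p n e).inv (Units.ne_zero _)

theorem smooth_v₁ : Smooth (fun p : CoframeBundle => p.v₁) := by
  intro p n e
  simp only [LieFrame.move, Prod.snd_sum, Prod.fst_sum, Prod.smul_snd, Prod.smul_fst,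
    Complex.real_smul]
  exact contDiffAt_const.add (contDiffAt_sum_ofReal_mul _)

theorem smooth_v₂ : Smooth (fun p : CoframeBundle => p.v₂) := by
  intro p n e
  simp only [LieFrame.move, Prod.snd_sum, Prod.fst_sum, Prod.smul_snd, Prod.smul_fst,
    Complex.real_smul]
  exact contDiffAt_const.add (contDiffAt_sum_ofReal_mul _)

theorem smooth_s : Smooth (fun p : CoframeBundle => p.s) := by
  intro p n e
  simp only [LieFrame.move, Prod.snd_sum, Prod.smul_snd, Complex.real_smul]
  exact contDiffAt_const.add (contDiffAt_sum_ofReal_mul _)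

end CoframeBundle

/-! ### Invariant coframes -/

/-- A left-invariant coframe `θ, θ¹, θ²` of `SU(2)` with `dθ = θ¹ ∧ θ²`,
`dθ¹ = θ ∧ (x θ¹ + y θ²)` and `dθ² = θ ∧ (z θ¹ - x θ²)`, in terms of the Lie bracket. -/
structure IsFlagCoframe (θ θ₁ θ₂ : OneForm SU2 su2) (x y z : ℂ) : Prop where
  inv : IsLeftInvariant θ
  inv₁ : IsLeftInvariant θ₁
  inv₂ : IsLeftInvariant θ₂
  bracket : ∀ g X Y, θ g (su2Bracket X Y) = -(θ₁ g X * θ₂ g Y - θ₁ g Y * θ₂ g X)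
  bracket₁ : ∀ g X Y, θ₁ g (su2Bracket X Y) =
    -(θ g X * (x * θ₁ g Y + y * θ₂ g Y) - θ g Y * (x * θ₁ g X + y * θ₂ g X))
  bracket₂ : ∀ g X Y, θ₂ g (su2Bracket X Y) =
    -(θ g X * (z * θ₁ g Y - x * θ₂ g Y) - θ g Y * (z * θ₁ g X - x * θ₂ g X))

theorem IsLeftInvariant.eq_one {η : OneForm SU2 su2} (h : IsLeftInvariant η) (g : SU2) :
    η g = η 1 := by simpa using h g 1

theorem IsLeftInvariant.smoothForm {η : OneForm SU2 su2} (h : IsLeftInvariant η) :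
    SmoothForm η := by
  intro X
  simp only [h.eq_one]
  exact Smooth.const _

theorem IsLeftInvariant.extD_apply {η : OneForm SU2 su2} (h : IsLeftInvariant η) (g : SU2)
    (X Y : su2) : extD η g X Y = -η g (su2Bracket X Y) := by
  have h' (Z : su2) (W : su2) : dirDeriv (fun q => η q Z) g W = 0 := by
    simp only [h.eq_one]
    exact (HasDirDeriv.const _).dirDeriv_eq _ _
  simp only [extD, h', LieFrame.bracket]
  ring

namespace CoframeBundle

/-- The form with the given coefficients with respect to
`θ, θ¹, θ², da₁ / a₁, da₂ / a₂, dv₁, dv₂, ds`. -/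
def frameForm (θ θ₁ θ₂ : OneForm SU2 su2) (c₀ c₁ c₂ d₁ d₂ k₁ k₂ k₀ : CoframeBundle → ℂ) :
    OneForm CoframeBundle CoframeTangent := fun p =>
  { toFun := fun X => c₀ p * θ p.g X.1 + c₁ p * θ₁ p.g X.1 + c₂ p * θ₂ p.g X.1 + d₁ p * X.2.1
      + d₂ p * X.2.2.1 + k₁ p * X.2.2.2.1 + k₂ p * X.2.2.2.2.1 + k₀ p * X.2.2.2.2.2
    map_add' := fun X Y => by simp only [Prod.fst_add, Prod.snd_add, map_add]; ring
    map_smul' := fun c X => by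
      simp only [Prod.smul_fst, Prod.smul_snd, map_smul, Complex.real_smul, RingHom.id_apply]
      ring }

section

variable {θ θ₁ θ₂ : OneForm SU2 su2} {x y z : ℂ}
  {c₀ c₁ c₂ d₁ d₂ k₁ k₂ k₀ : CoframeBundle → ℂ}
  {c₀' c₁' c₂' d₁' d₂' k₁' k₂' k₀' : CoframeBundle → CoframeTangent → ℂ}

theorem frameForm_apply (p : CoframeBundle) (X : CoframeTangent) :
    frameForm θ θ₁ θ₂ c₀ c₁ c₂ d₁ d₂ k₁ k₂ k₀ p X =
      c₀ p * θ p.g X.1 + c₁ p * θ₁ p.g X.1 + c₂ p * θ₂ p.g X.1 + d₁ p * X.2.1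
      + d₂ p * X.2.2.1 + k₁ p * X.2.2.2.1 + k₂ p * X.2.2.2.2.1 + k₀ p * X.2.2.2.2.2 := rfl

/-- The coefficients of θ, θ¹, θ² in the left-invariant frame are constant, so derivatives fall only
on the given functions. The remaining five coframe elements are closed, the bracket having no fibre
component; the last three lines are the structure constants. -/
theorem extD_frameForm (h : IsFlagCoframe θ θ₁ θ₂ x y z)
    (hc₀ : HasDirDeriv c₀ c₀') (hc₁ : HasDirDeriv c₁ c₁') (hc₂ : HasDirDeriv c₂ c₂')
    (hd₁ : HasDirDeriv d₁ d₁') (hd₂ : HasDirDeriv d₂ d₂')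
    (hk₁ : HasDirDeriv k₁ k₁') (hk₂ : HasDirDeriv k₂ k₂') (hk₀ : HasDirDeriv k₀ k₀')
    (p : CoframeBundle) (X Y : CoframeTangent) :
    extD (frameForm θ θ₁ θ₂ c₀ c₁ c₂ d₁ d₂ k₁ k₂ k₀) p X Y =
      (c₀' p X * θ p.g Y.1 - c₀' p Y * θ p.g X.1)
      + (c₁' p X * θ₁ p.g Y.1 - c₁' p Y * θ₁ p.g X.1)
      + (c₂' p X * θ₂ p.g Y.1 - c₂' p Y * θ₂ p.g X.1)
      + (d₁' p X * Y.2.1 - d₁' p Y * X.2.1) + (d₂' p X * Y.2.2.1 - d₂' p Y * X.2.2.1)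
      + (k₁' p X * Y.2.2.2.1 - k₁' p Y * X.2.2.2.1)
      + (k₂' p X * Y.2.2.2.2.1 - k₂' p Y * X.2.2.2.2.1)
      + (k₀' p X * Y.2.2.2.2.2 - k₀' p Y * X.2.2.2.2.2)
      + c₀ p * (θ₁ p.g X.1 * θ₂ p.g Y.1 - θ₁ p.g Y.1 * θ₂ p.g X.1)
      + c₁ p * (θ p.g X.1 * (x * θ₁ p.g Y.1 + y * θ₂ p.g Y.1)
        - θ p.g Y.1 * (x * θ₁ p.g X.1 + y * θ₂ p.g X.1))
      + c₂ p * (θ p.g X.1 * (z * θ₁ p.g Y.1 - x * θ₂ p.g Y.1)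
        - θ p.g Y.1 * (z * θ₁ p.g X.1 - x * θ₂ p.g X.1)) := by
  have key (X Y : CoframeTangent) :
      dirDeriv (fun q => frameForm θ θ₁ θ₂ c₀ c₁ c₂ d₁ d₂ k₁ k₂ k₀ q Y) p X =
      c₀' p X * θ p.g Y.1 + c₁' p X * θ₁ p.g Y.1 + c₂' p X * θ₂ p.g Y.1 + d₁' p X * Y.2.1
      + d₂' p X * Y.2.2.1 + k₁' p X * Y.2.2.2.1 + k₂' p X * Y.2.2.2.2.1
      + k₀' p X * Y.2.2.2.2.2 := by
    simp only [frameForm_apply, h.inv.eq_one, h.inv₁.eq_one, h.inv₂.eq_one]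
    have hd := (((((((hc₀.mul (.const (θ 1 Y.1))).add (hc₁.mul (.const (θ₁ 1 Y.1)))).add
      (hc₂.mul (.const (θ₂ 1 Y.1)))).add (hd₁.mul (.const Y.2.1))).add
      (hd₂.mul (.const Y.2.2.1))).add (hk₁.mul (.const Y.2.2.2.1))).add
      (hk₂.mul (.const Y.2.2.2.2.1))).add (hk₀.mul (.const Y.2.2.2.2.2))
    rw [hd.dirDeriv_eq]
    ring
  simp only [extD, key]
  simp only [frameForm_apply, LieFrame.bracket, h.bracket, h.bracket₁, h.bracket₂]
  ring

theorem smoothForm_frameForm (h : IsFlagCoframe θ θ₁ θ₂ x y z)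
    (hc₀ : Smooth c₀) (hc₁ : Smooth c₁) (hc₂ : Smooth c₂) (hd₁ : Smooth d₁) (hd₂ : Smooth d₂)
    (hk₁ : Smooth k₁) (hk₂ : Smooth k₂) (hk₀ : Smooth k₀) :
    SmoothForm (frameForm θ θ₁ θ₂ c₀ c₁ c₂ d₁ d₂ k₁ k₂ k₀) := by
  intro Y
  simp only [frameForm_apply, h.inv.eq_one, h.inv₁.eq_one, h.inv₂.eq_one]
  exact (((((((hc₀.mul (.const (θ 1 Y.1))).add (hc₁.mul (.const (θ₁ 1 Y.1)))).add
      (hc₂.mul (.const (θ₂ 1 Y.1)))).add (hd₁.mul (.const Y.2.1))).add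
      (hd₂.mul (.const Y.2.2.1))).add (hk₁.mul (.const Y.2.2.2.1))).add
      (hk₂.mul (.const Y.2.2.2.2.1))).add (hk₀.mul (.const Y.2.2.2.2.2))

variable (θ θ₁ θ₂)

theorem ω_apply (p : CoframeBundle) (X : CoframeTangent) :
    ω θ p X = p.a₁ * p.a₂ * θ p.g X.1 := rfl

theorem ω₁_apply (p : CoframeBundle) (X : CoframeTangent) :
    ω₁ θ θ₁ p X = p.a₁ * θ₁ p.g X.1 + p.v₁ * (p.a₁ * p.a₂) * θ p.g X.1 := rfl

theorem ω₂_apply (p : CoframeBundle) (X : CoframeTangent) :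
    ω₂ θ θ₂ p X = p.a₂ * θ₂ p.g X.1 + p.v₂ * (p.a₁ * p.a₂) * θ p.g X.1 := rfl

theorem φ_apply (p : CoframeBundle) (X : CoframeTangent) :
    φ θ θ₁ θ₂ p X = -(X.2.1 + X.2.2.1) + p.a₁ * p.v₂ * θ₁ p.g X.1 - p.a₂ * p.v₁ * θ₂ p.g X.1
      + p.s * θ p.g X.1 := rfl

theorem ω_eq_frameForm : ω θ = frameForm θ θ₁ θ₂ (fun p => p.a₁ * p.a₂) (fun _ => 0) (fun _ => 0)
    (fun _ => 0) (fun _ => 0) (fun _ => 0) (fun _ => 0) (fun _ => 0) := by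
  refine funext fun p => LinearMap.ext fun X => ?_
  rw [ω_apply, frameForm_apply]
  ring

theorem ω₁_eq_frameForm : ω₁ θ θ₁ = frameForm θ θ₁ θ₂ (fun p => p.v₁ * (p.a₁ * p.a₂))
    (fun p => p.a₁) (fun _ => 0) (fun _ => 0) (fun _ => 0) (fun _ => 0) (fun _ => 0)
    (fun _ => 0) := by
  refine funext fun p => LinearMap.ext fun X => ?_
  rw [ω₁_apply, frameForm_apply]
  ring

theorem ω₂_eq_frameForm : ω₂ θ θ₂ = frameForm θ θ₁ θ₂ (fun p => p.v₂ * (p.a₁ * p.a₂))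
    (fun _ => 0) (fun p => p.a₂) (fun _ => 0) (fun _ => 0) (fun _ => 0) (fun _ => 0)
    (fun _ => 0) := by
  refine funext fun p => LinearMap.ext fun X => ?_
  rw [ω₂_apply, frameForm_apply]
  ring

theorem φ_eq_frameForm : φ θ θ₁ θ₂ = frameForm θ θ₁ θ₂ (fun p => p.s)
    (fun p => p.a₁ * p.v₂) (fun p => -(p.a₂ * p.v₁)) (fun _ => -1) (fun _ => -1) (fun _ => 0)
    (fun _ => 0) (fun _ => 0) := by
  refine funext fun p => LinearMap.ext fun X => ?_
  rw [φ_apply, frameForm_apply]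
  ring

end

end CoframeBundle

/-! ### The adapted connection -/

namespace ConnectionData

open CoframeBundle

/-- The adapted connection of an invariant coframe, with its curvature functions. -/
def ofCoframe (θ θ₁ θ₂ : OneForm SU2 su2) (x y z : ℂ) : ConnectionData where
  -- Modulo θ the form is dictated by dω¹ and dω². The constant c = −3x/4 multiplying θ comes from
  -- dω¹₁: at v₁ = v₂ = s = 0 the θ¹ coefficient of a₂φ¹ and the θ² coefficient of a₁φ² are x + c
  -- and −(x + c), and comparing θ¹∧θ² terms gives c = −3(x + c).
  ω₁₁ := frameForm θ θ₁ θ₂ (fun p => -(3 / 4 * x) + 3 / 2 * (p.v₁ * p.v₂ * (p.a₁ * p.a₂)))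
    (fun p => 3 / 2 * (p.a₁ * p.v₂)) (fun p => 3 / 2 * (p.a₂ * p.v₁)) (fun _ => -(1 / 2))
    (fun _ => 1 / 2) (fun _ => 0) (fun _ => 0) (fun _ => 0)
  φ₁ := frameForm θ θ₁ θ₂
    (fun p => 3 / 4 * x * p.v₁ + 1 / 2 * (p.v₁ * (p.s - p.v₁ * p.v₂ * (p.a₁ * p.a₂))))
    (fun p => x / 4 * (p.a₂ : ℂ)⁻¹ + 1 / 2 * (p.s * (p.a₂ : ℂ)⁻¹ - p.v₁ * p.v₂ * p.a₁))
    (fun p => y * (p.a₂ : ℂ)⁻¹ - p.v₁ * p.v₁ * p.a₂)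
    (fun _ => 0) (fun p => -p.v₁) (fun _ => -1) (fun _ => 0) (fun _ => 0)
  φ₂ := frameForm θ θ₁ θ₂
    (fun p => -(3 / 4 * x * p.v₂) + 1 / 2 * (p.v₂ * (p.s + p.v₁ * p.v₂ * (p.a₁ * p.a₂))))
    (fun p => z * (p.a₁ : ℂ)⁻¹ + p.v₂ * p.v₂ * p.a₁)
    (fun p => -(x / 4 * (p.a₁ : ℂ)⁻¹) + 1 / 2 * (p.s * (p.a₁ : ℂ)⁻¹ + p.v₁ * p.v₂ * p.a₂))
    (fun p => -p.v₂) (fun _ => 0) (fun _ => 0) (fun _ => -1) (fun _ => 0)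
  -- The constant 2yz + x²/8 makes the θ∧θ¹ term of the equation for dφ¹ vanish at v₁ = v₂ = s = 0,
  -- where it reads (x²/16 + yz)/a₂ + a₁ψ₀/2 = 0 with ψ₀ the coefficient of θ.
  ψ := frameForm θ θ₁ θ₂
    (fun p => -(2 * y * z + x ^ 2 / 8) * ((p.a₁ : ℂ)⁻¹ * (p.a₂ : ℂ)⁻¹) + 3 / 2 * x * (p.v₁ * p.v₂)
      + 1 / 2 * (p.s * p.s * ((p.a₁ : ℂ)⁻¹ * (p.a₂ : ℂ)⁻¹)
        - p.v₁ * p.v₂ * (p.v₁ * p.v₂) * (p.a₁ * p.a₂)))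
    (fun p => -(2 * z * (p.v₁ * (p.a₁ : ℂ)⁻¹)) + x / 2 * (p.v₂ * (p.a₂ : ℂ)⁻¹)
      + p.v₂ * (p.s * (p.a₂ : ℂ)⁻¹ - p.v₁ * p.v₂ * p.a₁))
    (fun p => x / 2 * (p.v₁ * (p.a₁ : ℂ)⁻¹) + 2 * y * (p.v₂ * (p.a₂ : ℂ)⁻¹)
      - p.v₁ * (p.s * (p.a₁ : ℂ)⁻¹ + p.v₁ * p.v₂ * p.a₂))
    (fun p => p.v₁ * p.v₂) (fun p => -(p.v₁ * p.v₂)) (fun p => -p.v₂) (fun p => p.v₁)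
    (fun p => -((p.a₁ : ℂ)⁻¹ * (p.a₂ : ℂ)⁻¹))
  Q₁ p := -(3 / 2 * (x * y)) * ((p.a₁ : ℂ)⁻¹ * (p.a₂ : ℂ)⁻¹ ^ 3)
  Q₂ p := 3 / 2 * (x * z) * ((p.a₁ : ℂ)⁻¹ ^ 3 * (p.a₂ : ℂ)⁻¹)
  U₁ p := 3 * (x * z) * p.v₁ * ((p.a₁ : ℂ)⁻¹ ^ 3 * (p.a₂ : ℂ)⁻¹)
  U₂ p := 3 * (x * y) * p.v₂ * ((p.a₁ : ℂ)⁻¹ * (p.a₂ : ℂ)⁻¹ ^ 3)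

variable {θ θ₁ θ₂ : OneForm SU2 su2} {x y z : ℂ}

theorem hasDirDeriv_scale : HasDirDeriv (fun p : CoframeBundle => (p.a₁ * p.a₂ : ℂ))
    (fun p X => p.a₁ * p.a₂ * (X.2.1 + X.2.2.1)) := by
  convert hasDirDeriv_a₁.mul hasDirDeriv_a₂ using 3
  ring

theorem smooth_ofCoframe (h : IsFlagCoframe θ θ₁ θ₂ x y z) :
    SmoothForm (ofCoframe θ θ₁ θ₂ x y z).ω₁₁ ∧ SmoothForm (ofCoframe θ θ₁ θ₂ x y z).φ₁ ∧
    SmoothForm (ofCoframe θ θ₁ θ₂ x y z).φ₂ ∧ SmoothForm (ofCoframe θ θ₁ θ₂ x y z).ψ := by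
  refine ⟨smoothForm_frameForm h ?_ ?_ ?_ ?_ ?_ ?_ ?_ ?_,
    smoothForm_frameForm h ?_ ?_ ?_ ?_ ?_ ?_ ?_ ?_,
    smoothForm_frameForm h ?_ ?_ ?_ ?_ ?_ ?_ ?_ ?_,
    smoothForm_frameForm h ?_ ?_ ?_ ?_ ?_ ?_ ?_ ?_⟩
  all_goals
    repeat' first
      | exact Smooth.const _
      | exact smooth_a₁
      | exact smooth_a₂
      | exact smooth_inv_a₁
      | exact smooth_inv_a₂
      | exact smooth_v₁
      | exact smooth_v₂
      | exact smooth_s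
      | apply Smooth.add
      | apply Smooth.sub
      | apply Smooth.neg
      | apply Smooth.mul

/-! ### Verification of the structure equations. -/

theorem extD_ω (h : IsFlagCoframe θ θ₁ θ₂ x y z) : extD (CoframeBundle.ω θ) =
    wedge (CoframeBundle.ω θ) (CoframeBundle.φ θ θ₁ θ₂)
      + wedge (CoframeBundle.ω₁ θ θ₁) (CoframeBundle.ω₂ θ θ₂) := by
  funext p X Y
  conv_lhs => rw [ω_eq_frameForm θ θ₁ θ₂]
  rw [extD_frameForm h hasDirDeriv_scale (.const 0) (.const 0) (.const 0) (.const 0) (.const 0)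
    (.const 0) (.const 0)]
  simp only [Pi.add_apply, wedge, ω_apply, ω₁_apply, ω₂_apply, φ_apply]
  ring

theorem extD_ω₁ (h : IsFlagCoframe θ θ₁ θ₂ x y z) : extD (CoframeBundle.ω₁ θ θ₁) =
    (1 / 2 : ℂ) • wedge (CoframeBundle.ω₁ θ θ₁) (CoframeBundle.φ θ θ₁ θ₂)
      + wedge (CoframeBundle.ω₁ θ θ₁) (ofCoframe θ θ₁ θ₂ x y z).ω₁₁
      + wedge (CoframeBundle.ω θ) (ofCoframe θ θ₁ θ₂ x y z).φ₁ := by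
  funext p X Y
  conv_lhs => rw [ω₁_eq_frameForm θ θ₁ θ₂]
  rw [extD_frameForm h (hasDirDeriv_v₁.mul hasDirDeriv_scale) hasDirDeriv_a₁
    (.const 0) (.const 0) (.const 0) (.const 0) (.const 0) (.const 0)]
  simp only [Pi.add_apply, Pi.smul_apply, smul_eq_mul, wedge, ω_apply, ω₁_apply, φ_apply,
    ofCoframe, frameForm_apply]
  have h₁ := p.a₁.ne_zero
  have h₂ := p.a₂.ne_zero
  field_simp
  ring


theorem extD_ω₂ (h : IsFlagCoframe θ θ₁ θ₂ x y z) : extD (CoframeBundle.ω₂ θ θ₂) =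
    (1 / 2 : ℂ) • wedge (CoframeBundle.ω₂ θ θ₂) (CoframeBundle.φ θ θ₁ θ₂)
      - wedge (CoframeBundle.ω₂ θ θ₂) (ofCoframe θ θ₁ θ₂ x y z).ω₁₁
      + wedge (CoframeBundle.ω θ) (ofCoframe θ θ₁ θ₂ x y z).φ₂ := by
  funext p X Y
  conv_lhs => rw [ω₂_eq_frameForm θ θ₁ θ₂]
  rw [extD_frameForm h (hasDirDeriv_v₂.mul hasDirDeriv_scale) (.const 0) hasDirDeriv_a₂
    (.const 0) (.const 0) (.const 0) (.const 0) (.const 0)]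
  simp only [Pi.add_apply, Pi.sub_apply, Pi.smul_apply, smul_eq_mul, wedge, ω_apply, ω₂_apply,
    φ_apply, ofCoframe, frameForm_apply]
  have h₁ := p.a₁.ne_zero
  have h₂ := p.a₂.ne_zero
  field_simp
  ring

theorem extD_φ (h : IsFlagCoframe θ θ₁ θ₂ x y z) : extD (CoframeBundle.φ θ θ₁ θ₂) =
    wedge (CoframeBundle.ω₁ θ θ₁) (ofCoframe θ θ₁ θ₂ x y z).φ₂
      - wedge (CoframeBundle.ω₂ θ θ₂) (ofCoframe θ θ₁ θ₂ x y z).φ₁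
      + wedge (CoframeBundle.ω θ) (ofCoframe θ θ₁ θ₂ x y z).ψ := by
  funext p X Y
  conv_lhs => rw [φ_eq_frameForm θ θ₁ θ₂]
  rw [extD_frameForm h hasDirDeriv_s (hasDirDeriv_a₁.mul hasDirDeriv_v₂)
    (hasDirDeriv_a₂.mul hasDirDeriv_v₁).neg (.const _) (.const _) (.const 0) (.const 0) (.const 0)]
  simp only [Pi.add_apply, Pi.sub_apply, wedge, ω_apply, ω₁_apply, ω₂_apply,
    ofCoframe, frameForm_apply]
  have h₁ := p.a₁.ne_zero
  have h₂ := p.a₂.ne_zero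
  field_simp
  ring

theorem extD_ω₁₁ (h : IsFlagCoframe θ θ₁ θ₂ x y z) :
    extD (ofCoframe θ θ₁ θ₂ x y z).ω₁₁
      - (3 / 2 : ℂ) • wedge (CoframeBundle.ω₂ θ θ₂) (ofCoframe θ θ₁ θ₂ x y z).φ₁
      - (3 / 2 : ℂ) • wedge (CoframeBundle.ω₁ θ θ₁) (ofCoframe θ θ₁ θ₂ x y z).φ₂ = 0 := by
  funext p X Y
  rw [Pi.sub_apply, Pi.sub_apply, Pi.sub_apply, Pi.sub_apply, Pi.sub_apply, Pi.sub_apply,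
    show (ofCoframe θ θ₁ θ₂ x y z).ω₁₁ = frameForm _ _ _ _ _ _ _ _ _ _ _ from rfl,
    -- The derivative rules are composed in the exact shape of the coefficients in `ofCoframe`, so
    -- that unification recognises them; the same pattern serves the other curvature equations.
    extD_frameForm h
      (.add (.const _) (.mul (.const _) (.mul (hasDirDeriv_v₁.mul hasDirDeriv_v₂)
        hasDirDeriv_scale)))
      (.mul (.const _) (hasDirDeriv_a₁.mul hasDirDeriv_v₂))
      (.mul (.const _) (hasDirDeriv_a₂.mul hasDirDeriv_v₁))
      (.const _) (.const _) (.const 0) (.const 0) (.const 0)]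
  simp only [Pi.smul_apply, Pi.zero_apply, smul_eq_mul, wedge, ω₁_apply, ω₂_apply,
    ofCoframe, frameForm_apply]
  have h₁ := p.a₁.ne_zero
  have h₂ := p.a₂.ne_zero
  field_simp
  ring

theorem extD_φ₁ (h : IsFlagCoframe θ θ₁ θ₂ x y z) :
    extD (ofCoframe θ θ₁ θ₂ x y z).φ₁
      - wedge (ofCoframe θ θ₁ θ₂ x y z).φ₁ (ofCoframe θ θ₁ θ₂ x y z).ω₁₁
      - (1 / 2 : ℂ) • wedge (CoframeBundle.ω₁ θ θ₁) (ofCoframe θ θ₁ θ₂ x y z).ψ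
      - (1 / 2 : ℂ) • wedge (CoframeBundle.φ θ θ₁ θ₂) (ofCoframe θ θ₁ θ₂ x y z).φ₁ =
    fun p => (ofCoframe θ θ₁ θ₂ x y z).Q₁ p •
      wedge (CoframeBundle.ω θ) (CoframeBundle.ω₂ θ θ₂) p := by
  funext p X Y
  simp only [Pi.sub_apply]
  rw [show (ofCoframe θ θ₁ θ₂ x y z).φ₁ = frameForm _ _ _ _ _ _ _ _ _ _ _ from rfl,
    extD_frameForm h
      (.add (.mul (.const _) hasDirDeriv_v₁) (.mul (.const _) (hasDirDeriv_v₁.mul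
        (hasDirDeriv_s.sub ((hasDirDeriv_v₁.mul hasDirDeriv_v₂).mul hasDirDeriv_scale)))))
      (.add (.mul (.const _) hasDirDeriv_inv_a₂) (.mul (.const _)
        ((hasDirDeriv_s.mul hasDirDeriv_inv_a₂).sub
          ((hasDirDeriv_v₁.mul hasDirDeriv_v₂).mul hasDirDeriv_a₁))))
      (.sub (.mul (.const _) hasDirDeriv_inv_a₂)
        ((hasDirDeriv_v₁.mul hasDirDeriv_v₁).mul hasDirDeriv_a₂))
      (.const 0) hasDirDeriv_v₁.neg (.const _) (.const 0) (.const 0)]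
  simp only [Pi.smul_apply, smul_eq_mul, wedge, ω_apply, ω₁_apply, ω₂_apply, φ_apply,
    ofCoframe, frameForm_apply]
  have h₁ := p.a₁.ne_zero
  have h₂ := p.a₂.ne_zero
  field_simp
  ring

theorem extD_φ₂ (h : IsFlagCoframe θ θ₁ θ₂ x y z) :
    extD (ofCoframe θ θ₁ θ₂ x y z).φ₂
      + wedge (ofCoframe θ θ₁ θ₂ x y z).φ₂ (ofCoframe θ θ₁ θ₂ x y z).ω₁₁
      - (1 / 2 : ℂ) • wedge (CoframeBundle.ω₂ θ θ₂) (ofCoframe θ θ₁ θ₂ x y z).ψ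
      - (1 / 2 : ℂ) • wedge (CoframeBundle.φ θ θ₁ θ₂) (ofCoframe θ θ₁ θ₂ x y z).φ₂ =
    fun p => (ofCoframe θ θ₁ θ₂ x y z).Q₂ p •
      wedge (CoframeBundle.ω θ) (CoframeBundle.ω₁ θ θ₁) p := by
  funext p X Y
  simp only [Pi.sub_apply, Pi.add_apply]
  rw [show (ofCoframe θ θ₁ θ₂ x y z).φ₂ = frameForm _ _ _ _ _ _ _ _ _ _ _ from rfl,
    extD_frameForm h
      (.add (.neg (.mul (.const _) hasDirDeriv_v₂)) (.mul (.const _) (hasDirDeriv_v₂.mul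
        (hasDirDeriv_s.add ((hasDirDeriv_v₁.mul hasDirDeriv_v₂).mul hasDirDeriv_scale)))))
      (.add (.mul (.const _) hasDirDeriv_inv_a₁)
        ((hasDirDeriv_v₂.mul hasDirDeriv_v₂).mul hasDirDeriv_a₁))
      (.add (.neg (.mul (.const _) hasDirDeriv_inv_a₁)) (.mul (.const _)
        ((hasDirDeriv_s.mul hasDirDeriv_inv_a₁).add
          ((hasDirDeriv_v₁.mul hasDirDeriv_v₂).mul hasDirDeriv_a₂))))
      hasDirDeriv_v₂.neg (.const 0) (.const 0) (.const _) (.const 0)]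
  simp only [Pi.smul_apply, smul_eq_mul, wedge, ω_apply, ω₁_apply, ω₂_apply, φ_apply,
    ofCoframe, frameForm_apply]
  have h₁ := p.a₁.ne_zero
  have h₂ := p.a₂.ne_zero
  field_simp
  ring

theorem extD_ψ (h : IsFlagCoframe θ θ₁ θ₂ x y z) :
    extD (ofCoframe θ θ₁ θ₂ x y z).ψ
      - (2 : ℂ) • wedge (ofCoframe θ θ₁ θ₂ x y z).φ₁ (ofCoframe θ θ₁ θ₂ x y z).φ₂
      - wedge (CoframeBundle.φ θ θ₁ θ₂) (ofCoframe θ θ₁ θ₂ x y z).ψ =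
    fun p => (ofCoframe θ θ₁ θ₂ x y z).U₁ p •
        wedge (CoframeBundle.ω₁ θ θ₁) (CoframeBundle.ω θ) p
      + (ofCoframe θ θ₁ θ₂ x y z).U₂ p •
        wedge (CoframeBundle.ω₂ θ θ₂) (CoframeBundle.ω θ) p := by
  funext p X Y
  have hs := hasDirDeriv_inv_a₁.mul hasDirDeriv_inv_a₂
  have hv := hasDirDeriv_v₁.mul hasDirDeriv_v₂
  simp only [Pi.sub_apply]
  rw [show (ofCoframe θ θ₁ θ₂ x y z).ψ = frameForm _ _ _ _ _ _ _ _ _ _ _ from rfl,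
    extD_frameForm h
      (.add (.add (.mul (.const _) hs) (.mul (.const _) hv)) (.mul (.const _)
        (.sub ((hasDirDeriv_s.mul hasDirDeriv_s).mul hs) ((hv.mul hv).mul hasDirDeriv_scale))))
      (.add (.add (.neg (.mul (.const _) (hasDirDeriv_v₁.mul hasDirDeriv_inv_a₁)))
        (.mul (.const _) (hasDirDeriv_v₂.mul hasDirDeriv_inv_a₂)))
        (hasDirDeriv_v₂.mul ((hasDirDeriv_s.mul hasDirDeriv_inv_a₂).sub (hv.mul hasDirDeriv_a₁))))
      (.sub (.add (.mul (.const _) (hasDirDeriv_v₁.mul hasDirDeriv_inv_a₁))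
        (.mul (.const _) (hasDirDeriv_v₂.mul hasDirDeriv_inv_a₂)))
        (hasDirDeriv_v₁.mul ((hasDirDeriv_s.mul hasDirDeriv_inv_a₁).add (hv.mul hasDirDeriv_a₂))))
      hv hv.neg hasDirDeriv_v₂.neg hasDirDeriv_v₁ hs.neg]
  simp only [Pi.smul_apply, Pi.add_apply, smul_eq_mul, wedge, ω_apply, ω₁_apply, ω₂_apply,
    φ_apply, ofCoframe, frameForm_apply]
  have h₁ := p.a₁.ne_zero
  have h₂ := p.a₂.ne_zero
  field_simp
  ring

theorem isAdapted_ofCoframe (h : IsFlagCoframe θ θ₁ θ₂ x y z) :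
    (ofCoframe θ θ₁ θ₂ x y z).IsAdapted θ θ₁ θ₂ where
  smooth_ω₁₁ := (smooth_ofCoframe h).1
  smooth_φ₁ := (smooth_ofCoframe h).2.1
  smooth_φ₂ := (smooth_ofCoframe h).2.2.1
  smooth_ψ := (smooth_ofCoframe h).2.2.2
  d_ω := extD_ω h
  d_ω₁ := extD_ω₁ h
  d_ω₂ := extD_ω₂ h
  d_φ := extD_φ h
  curv_Ω₁₁ := extD_ω₁₁ h
  curv_Φ₁ := extD_φ₁ h
  curv_Φ₂ := extD_φ₂ h
  curv_Ψ := extD_ψ h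

end ConnectionData

/-- Vectors `u, v` spanning the kernel of `θ`, and a vector `w` transverse to it, on which the
coframe `θ, θ¹, θ²` takes prescribed values. -/
structure IsAdaptedFrame (θ θ₁ θ₂ : OneForm SU2 su2) (r₁ r₂ s₁ s₂ : ℂ) (u v w : su2) : Prop where
  det : r₁ * s₂ - r₂ * s₁ = 1
  θu : ∀ g, θ g u = 0
  θv : ∀ g, θ g v = 0
  θw : ∀ g, θ g w = 1
  θ₁u : ∀ g, θ₁ g u = r₁
  θ₁v : ∀ g, θ₁ g v = r₂
  θ₁w : ∀ g, θ₁ g w = 0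
  θ₂u : ∀ g, θ₂ g u = s₁
  θ₂v : ∀ g, θ₂ g v = s₂
  θ₂w : ∀ g, θ₂ g w = 0

/-! ### Uniqueness of the adapted connection. -/

namespace ConnectionData

open CoframeBundle

variable {θ θ₁ θ₂ : OneForm SU2 su2} {x y z r₁ r₂ s₁ s₂ : ℂ} {u v w : su2}
  {C C' : ConnectionData}

/-- A solution of a homogeneous linear system of determinant `1`. -/
theorem eq_zero_of_det (hdet : r₁ * s₂ - r₂ * s₁ = 1) {a b : ℂ} (h₁ : r₁ * a + s₁ * b = 0)
    (h₂ : r₂ * a + s₂ * b = 0) : a = 0 ∧ b = 0 :=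
  ⟨by linear_combination s₂ * h₁ - s₁ * h₂ - a * hdet,
    by linear_combination r₁ * h₂ - r₂ * h₁ - b * hdet⟩

/-- Put δ = `C'.ω₁₁` − `C.ω₁₁`. Evaluated on the lifts of u and v, which ω kills, the equations for
dω¹ and dω² give δ(U) = δ(V) = 0. Hence δ is a multiple of ω, and since ω([U, V]) = −λ is nonzero,
dδ(U, V) detects that multiple. -/
theorem IsAdapted.ω₁₁_unique (h : IsFlagCoframe θ θ₁ θ₂ x y z)
    (hf : IsAdaptedFrame θ θ₁ θ₂ r₁ r₂ s₁ s₂ u v w)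
    (hC : C.IsAdapted θ θ₁ θ₂) (hC' : C'.IsAdapted θ θ₁ θ₂) : C'.ω₁₁ = C.ω₁₁ := by
  have hdet := hf.det
  let U : CoframeTangent := (u, 0)
  let V : CoframeTangent := (v, 0)
  let W : CoframeTangent := (w, 0)
  have H₁ (p X Y) := (congr_fun₃ hC'.d_ω₁ p X Y).symm.trans (congr_fun₃ hC.d_ω₁ p X Y)
  have H₂ (p X Y) := (congr_fun₃ hC'.d_ω₂ p X Y).symm.trans (congr_fun₃ hC.d_ω₂ p X Y)
  simp only [Pi.add_apply, Pi.sub_apply, Pi.smul_apply, wedge] at H₁ H₂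
  have hU (p) : ω θ p U = 0 := by simp [ω_apply, U, hf.θu]
  have hV (p) : ω θ p V = 0 := by simp [ω_apply, V, hf.θv]
  have hW (p : CoframeBundle) : ω θ p W = p.a₁ * p.a₂ := by simp [ω_apply, W, hf.θw]
  have h₁U (p : CoframeBundle) : ω₁ θ θ₁ p U = p.a₁ * r₁ := by simp [ω₁_apply, U, hf.θu, hf.θ₁u]
  have h₁V (p : CoframeBundle) : ω₁ θ θ₁ p V = p.a₁ * r₂ := by simp [ω₁_apply, V, hf.θv, hf.θ₁v]
  have h₂U (p : CoframeBundle) : ω₂ θ θ₂ p U = p.a₂ * s₁ := by simp [ω₂_apply, U, hf.θu, hf.θ₂u]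
  have h₂V (p : CoframeBundle) : ω₂ θ θ₂ p V = p.a₂ * s₂ := by simp [ω₂_apply, V, hf.θv, hf.θ₂v]
  have hUV (p) : C'.ω₁₁ p U = C.ω₁₁ p U ∧ C'.ω₁₁ p V = C.ω₁₁ p V := by
    have e₁ := H₁ p U V
    have e₂ := H₂ p U V
    rw [hU, hV, h₁U, h₁V] at e₁
    rw [hU, hV, h₂U, h₂V] at e₂
    have f₁ : r₁ * (C'.ω₁₁ p V - C.ω₁₁ p V) + r₂ * (C.ω₁₁ p U - C'.ω₁₁ p U) = 0 :=
      mul_left_cancel₀ p.a₁.ne_zero (by linear_combination e₁)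
    have f₂ : s₁ * (C'.ω₁₁ p V - C.ω₁₁ p V) + s₂ * (C.ω₁₁ p U - C'.ω₁₁ p U) = 0 :=
      mul_left_cancel₀ p.a₂.ne_zero (by linear_combination -e₂)
    obtain ⟨k₁, k₂⟩ := eq_zero_of_det (by linear_combination hdet) f₁ f₂
    exact ⟨(sub_eq_zero.1 k₂).symm, sub_eq_zero.1 k₁⟩
  refine funext fun p => LinearMap.ext fun X => ?_
  have hp₁ := p.a₁.ne_zero
  have hp₂ := p.a₂.ne_zero
  -- Cramer's rule on the equation for dω¹ at (U, X) and (V, X): this is a₁δ = B ω at p.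
  have key (X) : p.a₁ * (C'.ω₁₁ p X - C.ω₁₁ p X) = ω θ p X *
      (s₂ * (C'.φ₁ p U - C.φ₁ p U) - s₁ * (C'.φ₁ p V - C.φ₁ p V)) := by
    have e₁ := H₁ p U X
    have e₂ := H₁ p V X
    rw [hU, h₁U, (hUV p).1] at e₁
    rw [hV, h₁V, (hUV p).2] at e₂
    linear_combination s₂ * e₁ - s₁ * e₂ - p.a₁ * (C'.ω₁₁ p X - C.ω₁₁ p X) * hdet
  set B := s₂ * (C'.φ₁ p U - C.φ₁ p U) - s₁ * (C'.φ₁ p V - C.φ₁ p V) with hB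
  have hΩ := (congr_fun₃ hC'.curv_Ω₁₁ p U V).trans (congr_fun₃ hC.curv_Ω₁₁ p U V).symm
  have hbr : ω θ p (LieFrame.bracket (P := CoframeBundle) U V) = -(p.a₁ * p.a₂) := by
    rw [ω_apply, show (LieFrame.bracket (P := CoframeBundle) U V).1 = su2Bracket u v from rfl,
      h.bracket, hf.θ₁u, hf.θ₁v, hf.θ₂u, hf.θ₂v]
    linear_combination -(p.a₁ * p.a₂ : ℂ) * hdet
  have k := key (LieFrame.bracket (P := CoframeBundle) U V)
  have kW := key W
  rw [hbr] at k
  rw [hW] at kW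
  -- Since δ(U) and δ(V) vanish at every point of Y, the rewriting is legitimate under the
  -- directional derivatives, and only the bracket term of dδ(U, V) survives.
  simp only [Pi.sub_apply, Pi.smul_apply, smul_eq_mul, wedge, extD, fun q => (hUV q).1,
    fun q => (hUV q).2, h₁U, h₁V, h₂U, h₂V] at hΩ
  have e₁ := H₂ p U W
  have e₂ := H₂ p V W
  rw [hU, hW, h₂U, (hUV p).1] at e₁
  rw [hV, hW, h₂V, (hUV p).2] at e₂
  have hB0 : B = 0 := by
    -- Here dδ(U, V) = −δ([U, V]) = a₂B, while the φ¹ and φ² terms of the equation for dω¹₁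
    -- contribute −(3/2)a₂B each. So a₂B = −3a₂B; the extra factor a₁a₂ avoids division.
    have e : (4 * p.a₂ * (p.a₁ * p.a₂) : ℂ) * B = 0 := by
      linear_combination p.a₁ * p.a₂ * hΩ + p.a₂ * k - 3 / 2 * p.a₁ * (r₁ * e₂ - r₂ * e₁)
        - 3 / 2 * p.a₂ * kW - 3 / 2 * p.a₁ * p.a₂ * (C'.ω₁₁ p W - C.ω₁₁ p W) * hdet
        - 3 / 2 * p.a₁ * p.a₂ * p.a₂ * hB
    simpa using e
  have := key X
  rw [hB0, mul_zero] at this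
  exact sub_eq_zero.1 ((mul_eq_zero.1 this).resolve_left hp₁)

theorem IsAdapted.unique (h : IsFlagCoframe θ θ₁ θ₂ x y z)
    (hf : IsAdaptedFrame θ θ₁ θ₂ r₁ r₂ s₁ s₂ u v w)
    (hC : C.IsAdapted θ θ₁ θ₂) (hC' : C'.IsAdapted θ θ₁ θ₂) : C' = C := by
  have hdet := hf.det
  let U : CoframeTangent := (u, 0)
  let V : CoframeTangent := (v, 0)
  let W : CoframeTangent := (w, 0)
  have hU (p) : ω θ p U = 0 := by simp [ω_apply, U, hf.θu]
  have hV (p) : ω θ p V = 0 := by simp [ω_apply, V, hf.θv]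
  have hW (p : CoframeBundle) : ω θ p W = p.a₁ * p.a₂ := by simp [ω_apply, W, hf.θw]
  have h₁U (p : CoframeBundle) : ω₁ θ θ₁ p U = p.a₁ * r₁ := by simp [ω₁_apply, U, hf.θu, hf.θ₁u]
  have h₁V (p : CoframeBundle) : ω₁ θ θ₁ p V = p.a₁ * r₂ := by simp [ω₁_apply, V, hf.θv, hf.θ₁v]
  have h₂U (p : CoframeBundle) : ω₂ θ θ₂ p U = p.a₂ * s₁ := by simp [ω₂_apply, U, hf.θu, hf.θ₂u]
  have h₂V (p : CoframeBundle) : ω₂ θ θ₂ p V = p.a₂ * s₂ := by simp [ω₂_apply, V, hf.θv, hf.θ₂v]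
  have hscale (p : CoframeBundle) : (p.a₁ * p.a₂ : ℂ) ≠ 0 :=
    mul_ne_zero p.a₁.ne_zero p.a₂.ne_zero
  -- forms whose difference is annihilated by `ω ∧ ·`
  have prop {η η' : OneForm CoframeBundle CoframeTangent} {p : CoframeBundle}
      (hη : ∀ X Y, wedge (ω θ) η' p X Y = wedge (ω θ) η p X Y) (X) :
      p.a₁ * p.a₂ * (η' p X - η p X) = ω θ p X * (η' p W - η p W) := by
    have e := hη W X
    simp only [wedge, hW] at e
    linear_combination e
  have vanish {η η' : OneForm CoframeBundle CoframeTangent} {p : CoframeBundle}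
      (hη : ∀ X Y, wedge (ω θ) η' p X Y = wedge (ω θ) η p X Y) {X} (hX : ω θ p X = 0) :
      η' p X = η p X := by
    have e := prop hη X
    rw [hX, zero_mul] at e
    exact sub_eq_zero.1 ((mul_eq_zero.1 e).resolve_left (hscale p))
  have all {η η' : OneForm CoframeBundle CoframeTangent} {p : CoframeBundle}
      (hη : ∀ X Y, wedge (ω θ) η' p X Y = wedge (ω θ) η p X Y) (hX : η' p W - η p W = 0) :
      η' p = η p := by
    refine LinearMap.ext fun X => ?_
    have e := prop hη X
    rw [hX, mul_zero] at e
    exact sub_eq_zero.1 ((mul_eq_zero.1 e).resolve_left (hscale p))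
  have hω₁₁ := hC.ω₁₁_unique h hf hC'
  have hw₁ (p X Y) : wedge (ω θ) C'.φ₁ p X Y = wedge (ω θ) C.φ₁ p X Y := by
    have e := (congr_fun₃ hC'.d_ω₁ p X Y).symm.trans (congr_fun₃ hC.d_ω₁ p X Y)
    simpa only [Pi.add_apply, hω₁₁, add_right_inj] using e
  have hw₂ (p X Y) : wedge (ω θ) C'.φ₂ p X Y = wedge (ω θ) C.φ₂ p X Y := by
    have e := (congr_fun₃ hC'.d_ω₂ p X Y).symm.trans (congr_fun₃ hC.d_ω₂ p X Y)
    simpa only [Pi.add_apply, hω₁₁, add_right_inj] using e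
  -- With ω¹₁ fixed, the differences of φ¹ and φ² are multiples of ω, and ω²∧Δφ¹ + ω¹∧Δφ² = 0.
  -- Independence of ω∧ω¹ and ω∧ω² kills both.
  have hφ (p) : C'.φ₁ p W - C.φ₁ p W = 0 ∧ C'.φ₂ p W - C.φ₂ p W = 0 := by
    have hΩ (X Y) := (congr_fun₃ hC'.curv_Ω₁₁ p X Y).trans (congr_fun₃ hC.curv_Ω₁₁ p X Y).symm
    simp only [Pi.sub_apply, Pi.smul_apply, smul_eq_mul, wedge, hω₁₁] at hΩ
    have e₁ := hΩ U W
    have e₂ := hΩ V W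
    rw [vanish (hw₁ p) (hU p), vanish (hw₂ p) (hU p), h₁U, h₂U] at e₁
    rw [vanish (hw₁ p) (hV p), vanish (hw₂ p) (hV p), h₁V, h₂V] at e₂
    obtain ⟨k₂, k₁⟩ := eq_zero_of_det (a := p.a₁ * (C'.φ₂ p W - C.φ₂ p W))
      (b := p.a₂ * (C'.φ₁ p W - C.φ₁ p W)) hdet (by linear_combination (-2 / 3 : ℂ) * e₁)
      (by linear_combination (-2 / 3 : ℂ) * e₂)
    exact ⟨(mul_eq_zero.1 k₁).resolve_left p.a₂.ne_zero,
      (mul_eq_zero.1 k₂).resolve_left p.a₁.ne_zero⟩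
  have hφ₁ : C'.φ₁ = C.φ₁ := funext fun p => all (hw₁ p) (hφ p).1
  have hφ₂ : C'.φ₂ = C.φ₂ := funext fun p => all (hw₂ p) (hφ p).2
  have hw₀ (p X Y) : wedge (ω θ) C'.ψ p X Y = wedge (ω θ) C.ψ p X Y := by
    have e := (congr_fun₃ hC'.d_φ p X Y).symm.trans (congr_fun₃ hC.d_φ p X Y)
    simpa only [Pi.add_apply, hφ₁, hφ₂, add_right_inj] using e
  -- The differences satisfy −½ ω¹∧Δψ = ΔQ¹ ω∧ω² with Δψ a multiple of ω, so the two sides are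
  -- independent and both vanish.
  have hQ₁ (p) : C'.ψ p W - C.ψ p W = 0 ∧ C'.Q₁ p - C.Q₁ p = 0 := by
    have e₁ := congr_arg₂ (· - ·) (congr_fun₃ hC'.curv_Φ₁ p U W) (congr_fun₃ hC.curv_Φ₁ p U W)
    have e₂ := congr_arg₂ (· - ·) (congr_fun₃ hC'.curv_Φ₁ p V W) (congr_fun₃ hC.curv_Φ₁ p V W)
    simp only [Pi.sub_apply, Pi.smul_apply, smul_eq_mul, wedge, hω₁₁, hφ₁,
      vanish (hw₀ p) (hU p), vanish (hw₀ p) (hV p), hU, hV, hW, h₁U, h₁V, h₂U, h₂V] at e₁ e₂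
    obtain ⟨k₁, k₂⟩ := eq_zero_of_det (a := p.a₁ * (C'.ψ p W - C.ψ p W))
      (b := p.a₁ * p.a₂ * p.a₂ * -(2 * (C'.Q₁ p - C.Q₁ p))) hdet (by linear_combination (-2) * e₁)
      (by linear_combination (-2) * e₂)
    refine ⟨(mul_eq_zero.1 k₁).resolve_left p.a₁.ne_zero, ?_⟩
    simpa using k₂
  have hψ : C'.ψ = C.ψ := funext fun p => all (hw₀ p) (hQ₁ p).1
  have hQ₂ (p) : C'.Q₂ p - C.Q₂ p = 0 := by
    have e₁ := congr_arg₂ (· - ·) (congr_fun₃ hC'.curv_Φ₂ p U W) (congr_fun₃ hC.curv_Φ₂ p U W)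
    have e₂ := congr_arg₂ (· - ·) (congr_fun₃ hC'.curv_Φ₂ p V W) (congr_fun₃ hC.curv_Φ₂ p V W)
    simp only [Pi.sub_apply, Pi.add_apply, Pi.smul_apply, smul_eq_mul, wedge, hω₁₁, hφ₂, hψ,
      hU, hV, hW, h₁U, h₁V] at e₁ e₂
    have k := (eq_zero_of_det (a := p.a₁ * p.a₁ * p.a₂ * (C'.Q₂ p - C.Q₂ p)) (b := 0) hdet
      (by linear_combination e₁) (by linear_combination e₂)).1
    simpa using k
  have hψU (p) : C'.U₁ p - C.U₁ p = 0 ∧ C'.U₂ p - C.U₂ p = 0 := by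
    have e₁ := congr_arg₂ (· - ·) (congr_fun₃ hC'.curv_Ψ p U W) (congr_fun₃ hC.curv_Ψ p U W)
    have e₂ := congr_arg₂ (· - ·) (congr_fun₃ hC'.curv_Ψ p V W) (congr_fun₃ hC.curv_Ψ p V W)
    simp only [Pi.sub_apply, Pi.add_apply, Pi.smul_apply, smul_eq_mul, wedge, hφ₁, hφ₂, hψ,
      hU, hV, hW, h₁U, h₁V, h₂U, h₂V] at e₁ e₂
    obtain ⟨k₁, k₂⟩ := eq_zero_of_det (a := p.a₁ * p.a₁ * p.a₂ * (C'.U₁ p - C.U₁ p))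
      (b := p.a₁ * p.a₂ * p.a₂ * (C'.U₂ p - C.U₂ p)) hdet
      (by linear_combination -e₁) (by linear_combination -e₂)
    exact ⟨by simpa using k₁, by simpa using k₂⟩
  cases C
  cases C'
  simp only at hω₁₁ hφ₁ hφ₂ hψ hQ₁ hQ₂ hψU
  simp only [mk.injEq]
  exact ⟨hω₁₁, hφ₁, hφ₂, hψ, funext fun p => sub_eq_zero.1 (hQ₁ p).2,
    funext fun p => sub_eq_zero.1 (hQ₂ p), funext fun p => sub_eq_zero.1 (hψU p).1,
    funext fun p => sub_eq_zero.1 (hψU p).2⟩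

end ConnectionData

/-! ### The dual frame and the flag structure -/

instance : Module.Finite ℝ su2 := by
  have : Module.Finite ℝ (Matrix (Fin 2) (Fin 2) ℂ) := Module.Finite.trans ℂ _
  exact inferInstance

/-- Real left-invariant 1-forms are the real linear functionals on the Lie algebra. -/
def realLeftInvariantFormsEquiv : realLeftInvariantForms ≃ₗ[ℝ] Module.Dual ℝ su2 where
  toFun η := Complex.reLm ∘ₗ (η : OneForm SU2 su2) 1
  invFun L := ⟨fun _ => Complex.ofRealCLM.toLinearMap ∘ₗ L, fun _ _ => rfl, fun g X => by simp⟩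
  map_add' η ξ := by ext; simp
  map_smul' c η := by ext; simp
  left_inv η := by
    refine Subtype.ext (funext fun g => LinearMap.ext fun X => Complex.ext ?_ ?_)
    · simp [IsLeftInvariant.eq_one η.2.1 g]
    · simpa using (η.2.2 g X).symm
  right_inv L := by ext; simp

/-- The frame of left-invariant vector fields dual to a basis of the left-invariant forms. -/
theorem exists_dual_basis (b : Module.Basis (Fin 3) ℝ realLeftInvariantForms) :
    ∃ e : Module.Basis (Fin 3) ℝ su2, ∀ i j g, (b i : OneForm SU2 su2) g (e j) =
      if i = j then 1 else 0 := by
  -- The dual basis of the transported basis lives in the double dual of su(2); evaluation, an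
  -- isomorphism in finite dimension, brings it back to su(2).
  let B := b.map realLeftInvariantFormsEquiv
  refine ⟨B.dualBasis.map (Module.evalEquiv ℝ su2).symm, fun i j g => ?_⟩
  have h : B i (B.dualBasis.map (Module.evalEquiv ℝ su2).symm j) = if i = j then 1 else 0 := by
    rw [Module.Basis.map_apply]
    exact (Module.apply_evalEquiv_symm_apply _ _ (B i) (B.dualBasis j)).trans (B.dualBasis_apply_self j i)
  rw [IsLeftInvariant.eq_one (b i).2.1 g]
  refine Complex.ext (h.trans ?_) (((b i).2.2 _ _).trans ?_) <;> split_ifs <;> simp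

variable {θ θ₁ θ₂ : OneForm SU2 su2} {x y z r₁ r₂ s₁ s₂ : ℂ}

theorem isFlagCoframe_of_extD (h : IsLeftInvariant θ) (h₁ : IsLeftInvariant θ₁)
    (h₂ : IsLeftInvariant θ₂) (d : extD θ = wedge θ₁ θ₂)
    (d₁ : ∀ g X Y, extD θ₁ g X Y =
      θ g X * (x * θ₁ g Y + y * θ₂ g Y) - θ g Y * (x * θ₁ g X + y * θ₂ g X))
    (d₂ : ∀ g X Y, extD θ₂ g X Y =
      θ g X * (z * θ₁ g Y - x * θ₂ g Y) - θ g Y * (z * θ₁ g X - x * θ₂ g X)) :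
    IsFlagCoframe θ θ₁ θ₂ x y z where
  inv := h
  inv₁ := h₁
  inv₂ := h₂
  bracket g X Y := by rw [← neg_eq_iff_eq_neg, ← h.extD_apply, d, wedge]
  bracket₁ g X Y := by rw [← neg_eq_iff_eq_neg, ← h₁.extD_apply, d₁]
  bracket₂ g X Y := by rw [← neg_eq_iff_eq_neg, ← h₂.extD_apply, d₂]

section LinearAlgebra

variable {M : Type*} [AddCommGroup M] [Module ℂ M] {f f₁ f₂ : M →ₗ[ℂ] ℂ} {w₁ w₂ : M}

/-- For w in the intersection, w − f₁(w)w₁ is annihilated by f, f₁ and f₂, hence is zero. -/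
theorem ker_inf_ker_eq_span (hinj : ∀ w, f w = 0 → f₁ w = 0 → f₂ w = 0 → w = 0)
    (h : f w₁ = 0) (h₁ : f₁ w₁ = 1) (h₂ : f₂ w₁ = 0) :
    LinearMap.ker f ⊓ LinearMap.ker f₂ = Submodule.span ℂ {w₁} := by
  refine le_antisymm (fun w hw => ?_) ?_
  · simp only [Submodule.mem_inf, LinearMap.mem_ker] at hw
    refine Submodule.mem_span_singleton.2 ⟨f₁ w, (sub_eq_zero.1 (hinj _ ?_ ?_ ?_)).symm⟩ <;>
      simp [hw, h, h₁, h₂]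
  · rw [Submodule.span_singleton_le_iff_mem]
    simp [h, h₂]

theorem ker_eq_sup (hinj : ∀ w, f w = 0 → f₁ w = 0 → f₂ w = 0 → w = 0)
    (h : f w₁ = 0) (h₁ : f₁ w₁ = 1) (h₂ : f₂ w₁ = 0)
    (k : f w₂ = 0) (k₁ : f₁ w₂ = 0) (k₂ : f₂ w₂ = 1) :
    LinearMap.ker f =
      (LinearMap.ker f ⊓ LinearMap.ker f₂) ⊔ (LinearMap.ker f ⊓ LinearMap.ker f₁) := by
  refine le_antisymm (fun w hw => ?_) (sup_le inf_le_left inf_le_left)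
  rw [LinearMap.mem_ker] at hw
  have : w = f₁ w • w₁ + f₂ w • w₂ := by
    refine sub_eq_zero.1 (hinj _ ?_ ?_ ?_) <;> simp [hw, h, h₁, h₂, k, k₁, k₂]
  rw [this]
  refine Submodule.add_mem_sup ?_ ?_ <;> simp [h, h₂, k, k₁]

end LinearAlgebra

/-- The two line fields defined by an invariant coframe form a flag structure. -/
theorem IsFlagCoframe.isFlagStructure (h : IsFlagCoframe θ θ₁ θ₂ x y z)
    (e : Module.Basis (Fin 3) ℝ su2)
    (hf : IsAdaptedFrame θ θ₁ θ₂ r₁ r₂ s₁ s₂ (e 1) (e 0) (e 2)) :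
    IsFlagStructure (fun g => kerC (θ g) ⊓ kerC (θ₂ g)) (fun g => kerC (θ g) ⊓ kerC (θ₁ g)) := by
  have hdet := hf.det
  -- The coefficients form the inverse of the matrix of rᵢ, sᵢ: w₁ and w₂ lie in the kernel of θ and
  -- are dual to θ¹, θ², so they span the two lines.
  let w₁ : su2C := s₂ ⊗ₜ e 1 - s₁ ⊗ₜ e 0
  let w₂ : su2C := r₁ ⊗ₜ e 0 - r₂ ⊗ₜ e 1
  have hinj (g : SU2) (w : su2C) (h : (θ g).liftBaseChange ℂ w = 0)
      (h₁ : (θ₁ g).liftBaseChange ℂ w = 0) (h₂ : (θ₂ g).liftBaseChange ℂ w = 0) : w = 0 := by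
    let E := e.baseChange ℂ
    have hw := E.sum_repr w
    rw [← hw] at h h₁ h₂
    simp only [Fin.sum_univ_three, map_add, map_smul, E, Module.Basis.baseChange_apply,
      LinearMap.liftBaseChange_tmul, smul_eq_mul, hf.θu, hf.θv, hf.θw, hf.θ₁u, hf.θ₁v,
      hf.θ₁w, hf.θ₂u, hf.θ₂v, hf.θ₂w] at h h₁ h₂
    obtain ⟨k₁, k₀⟩ := ConnectionData.eq_zero_of_det (a := E.repr w 1) (b := E.repr w 0)
      (r₁ := r₁) (r₂ := s₁) (s₁ := r₂) (s₂ := s₂) (by linear_combination hdet)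
      (by linear_combination h₁) (by linear_combination h₂)
    have k₂ : E.repr w 2 = 0 := by linear_combination h
    rw [← hw, Fin.sum_univ_three, k₀, k₁, k₂]
    simp
  have a (g) : (θ g).liftBaseChange ℂ w₁ = 0 := by simp [w₁, hf.θu, hf.θv]
  have a₁ (g) : (θ₁ g).liftBaseChange ℂ w₁ = 1 := by
    simp only [w₁, map_sub, LinearMap.liftBaseChange_tmul, hf.θ₁u, hf.θ₁v, smul_eq_mul]
    linear_combination hdet
  have a₂ (g) : (θ₂ g).liftBaseChange ℂ w₁ = 0 := by
    simp only [w₁, map_sub, LinearMap.liftBaseChange_tmul, hf.θ₂u, hf.θ₂v, smul_eq_mul]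
    ring
  have c (g) : (θ g).liftBaseChange ℂ w₂ = 0 := by simp [w₂, hf.θu, hf.θv]
  have c₁ (g) : (θ₁ g).liftBaseChange ℂ w₂ = 0 := by
    simp only [w₂, map_sub, LinearMap.liftBaseChange_tmul, hf.θ₁u, hf.θ₁v, smul_eq_mul]
    ring
  have c₂ (g) : (θ₂ g).liftBaseChange ℂ w₂ = 1 := by
    simp only [w₂, map_sub, LinearMap.liftBaseChange_tmul, hf.θ₂u, hf.θ₂v, smul_eq_mul]
    linear_combination hdet
  refine ⟨⟨fun g => ?_, fun g₀ => ⟨θ, θ₂, h.inv.smoothForm, h.inv₂.smoothForm, .of_forall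
    fun _ => rfl⟩⟩, ⟨fun g => ?_, fun g₀ => ⟨θ, θ₁, h.inv.smoothForm, h.inv₁.smoothForm, .of_forall
    fun _ => rfl⟩⟩, fun g => ?_, fun g₀ => ⟨θ, h.inv.smoothForm, .of_forall fun g => ⟨?_, ?_⟩⟩⟩
  · rw [kerC, kerC, ker_inf_ker_eq_span (hinj g) (a g) (a₁ g) (a₂ g)]
    refine finrank_span_singleton fun h0 => ?_
    simpa [h0] using a₁ g
  · rw [kerC, kerC, ker_inf_ker_eq_span (fun w k k₂ k₁ => hinj g w k k₁ k₂) (c g) (c₂ g) (c₁ g)]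
    refine finrank_span_singleton fun h0 => ?_
    simpa [h0] using c₂ g
  · rw [eq_bot_iff]
    rintro w ⟨⟨k, k₂⟩, -, k₁⟩
    exact hinj g w k k₁ k₂
  · exact ker_eq_sup (hinj g) (a g) (a₁ g) (a₂ g) (c g) (c₁ g) (c₂ g)
  · intro h0
    -- On this triple dθ∧θ takes the value r₁s₂ − r₂s₁ = 1.
    have k := congr_fun₃ h0 (e 1) (e 0) (e 2)
    simp only [wedge21, h.inv.extD_apply, h.bracket, hf.θu, hf.θv, hf.θw, hf.θ₁u, hf.θ₁v, hf.θ₂u,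
      hf.θ₂v, Pi.zero_apply] at k
    exact one_ne_zero (α := ℂ) (by linear_combination k - hdet)

/-! ### Sections of the coframe bundle -/

theorem su2Exp_zero_smul (X : su2) : su2Exp ((0 : ℝ) • X) = 1 := by
  ext1
  simp [su2Exp]

namespace CoframeSection

open CoframeBundle

variable {θ θ₁ θ₂ : OneForm SU2 su2} {x y z r₁ r₂ s₁ s₂ : ℂ}

theorem dirDeriv_const (c : ℂ) (g : SU2) (X : su2) : dirDeriv (fun _ : SU2 => c) g X = 0 :=
  (HasDirDeriv.const c).dirDeriv_eq g X

theorem dlog_const (a : ℂˣ) (g : SU2) (X : su2) : dlog (fun _ => a) g X = 0 := by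
  rw [dlog, dirDeriv_const, zero_div]

theorem dlog_inv {a : SU2 → ℂˣ} (ha : Smooth fun g => (a g : ℂ)) (g : SU2) (X : su2) :
    dlog (fun h => (a h)⁻¹) g X = -dlog a g X := by
  have hne := (a g).ne_zero
  have h := deriv_fun_inv'' (ha.differentiableAt g X) (Units.ne_zero _)
  simp only [LieFrame.move, su2Exp_zero_smul, mul_one] at h
  simp only [dlog, dirDeriv, LieFrame.move, Units.val_inv_eq_inv_val, h]
  field_simp

/-- The logarithmic derivative of a smooth function is a 1-form. -/
theorem exists_dlogForm {a : SU2 → ℂˣ} (ha : Smooth fun g => (a g : ℂ)) :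
    ∃ η : OneForm SU2 su2, ∀ g X, η g X = dlog a g X := by
  choose L hL using ha.exists_dirDeriv_eq
  refine ⟨fun g => (a g : ℂ)⁻¹ • L g, fun g X => ?_⟩
  rw [LinearMap.smul_apply, hL, dlog, smul_eq_mul, div_eq_inv_mul]

theorem tangent_ofX {a : SU2 → ℂˣ} (ha : Smooth fun g => (a g : ℂ)) (g : SU2) (X : su2) :
    (ofX a).tangent g X = (X, dlog a g X, -dlog a g X, 0, 0, 0) := by
  have h0 : dirDeriv (0 : SU2 → ℂ) g X = 0 := dirDeriv_const 0 g X
  simp [tangent, ofX, dlog_inv ha, h0]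

/-- Evaluating σ*ω = θ on w gives λ = 1, so the dλ/λ part of φ pulls back to zero. What remains of
σ*φ is a combination of θ¹, θ², θ with coefficients a₁v₂, −a₂v₁, s. -/
theorem pullback_ω_φ_iff
    (hf : ∃ u v w, IsAdaptedFrame θ θ₁ θ₂ r₁ r₂ s₁ s₂ u v w) {σ : CoframeSection}
    (hσ : σ.IsSmooth) :
    ((σ.pullback₁ (CoframeBundle.ω θ) = fun g X => θ g X) ∧
      σ.pullback₁ (CoframeBundle.φ θ θ₁ θ₂) = 0) ↔ ∃ a : SU2 → ℂˣ, σ = ofX a := by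
  obtain ⟨u, v, w, hf⟩ := hf
  constructor
  · rintro ⟨hω, hφ⟩
    have hscale (g) : (σ.a₁ g * σ.a₂ g : ℂ) = 1 := by
      have e : (σ.a₁ g * σ.a₂ g : ℂ) * θ g w = θ g w := congr_fun₂ hω g w
      simpa [hf.θw] using e
    have ha₂ : σ.a₂ = fun g => (σ.a₁ g)⁻¹ :=
      funext fun g => eq_inv_of_mul_eq_one_right (Units.ext (hscale g))
    have key (g X) : σ.a₁ g * σ.v₂ g * θ₁ g X - σ.a₂ g * σ.v₁ g * θ₂ g X + σ.s g * θ g X = 0 := by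
      have e : -(dlog σ.a₁ g X + dlog σ.a₂ g X) + σ.a₁ g * σ.v₂ g * θ₁ g X
        - σ.a₂ g * σ.v₁ g * θ₂ g X + σ.s g * θ g X = 0 := congr_fun₂ hφ g X
      have e' : dlog σ.a₂ g X = -dlog σ.a₁ g X := by rw [ha₂, dlog_inv hσ.a₁]
      linear_combination e + e'
    have hv (g) : σ.v₁ g = 0 ∧ σ.v₂ g = 0 := by
      have e₁ := key g u
      have e₂ := key g v
      rw [hf.θ₁u, hf.θ₂u, hf.θu] at e₁
      rw [hf.θ₁v, hf.θ₂v, hf.θv] at e₂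
      obtain ⟨k₁, k₂⟩ := ConnectionData.eq_zero_of_det (a := σ.a₁ g * σ.v₂ g)
        (b := -(σ.a₂ g * σ.v₁ g)) hf.det (by linear_combination e₁) (by linear_combination e₂)
      exact ⟨by simpa using k₂, by simpa using k₁⟩
    refine ⟨σ.a₁, CoframeSection.ext rfl ha₂ (funext fun g => (hv g).1) (funext fun g => (hv g).2)
      (funext fun g => ?_)⟩
    have e := key g w
    rwa [hf.θ₁w, hf.θ₂w, hf.θw, mul_zero, mul_zero, sub_zero, zero_add, mul_one] at e
  · rintro ⟨a, rfl⟩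
    refine ⟨?_, ?_⟩
    · funext g X
      simp [pullback₁, ω_apply, tangent, toFun, ofX]
    · funext g X
      rw [pullback₁, tangent_ofX (a := a) hσ.a₁, φ_apply]
      simp [toFun, ofX]

theorem pullback_ω₁ (a : SU2 → ℂˣ) :
    (ofX a).pullback₁ (CoframeBundle.ω₁ θ θ₁) = fun g X => (a g : ℂ) * θ₁ g X := by
  funext g X
  simp [pullback₁, ω₁_apply, tangent, toFun, ofX]

theorem pullback_ω₂ (a : SU2 → ℂˣ) :
    (ofX a).pullback₁ (CoframeBundle.ω₂ θ θ₂) = fun g X => (a g : ℂ)⁻¹ * θ₂ g X := by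
  funext g X
  simp [pullback₁, ω₂_apply, tangent, toFun, ofX]

/-- In tr(π∧π∧π) the form ω¹₁, which pulls back to −da/a − (3/4)xθ, is the only source of da/a. It
enters through 3 ω¹₁∧(φ²∧ω¹ + φ¹∧ω²), whose second factor pulls back to (x/2)θ¹∧θ²; all other powers
of a cancel. -/
theorem pullback_chernSimons {a : SU2 → ℂˣ} (ha : Smooth fun g => (a g : ℂ))
    {η : OneForm SU2 su2} (hη : ∀ g X, η g X = dlog a g X) :
    (ofX a).pullback₃ ((ConnectionData.ofCoframe θ θ₁ θ₂ x y z).chernSimons θ θ₁ θ₂) =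
      (-(1 / (8 * (Real.pi : ℂ) ^ 2)) * (2 * y * z + x ^ 2 / 2)) • wedge3 θ θ₁ θ₂
        - (x / (16 * (Real.pi : ℂ) ^ 2)) • wedge3 η θ₁ θ₂ := by
  let C := ConnectionData.ofCoframe θ θ₁ θ₂ x y z
  have eω (g X) : CoframeBundle.ω θ ((ofX a).toFun g) ((ofX a).tangent g X) = θ g X := by
    simp [ω_apply, tangent, toFun, ofX]
  have eω₁ (g X) : CoframeBundle.ω₁ θ θ₁ ((ofX a).toFun g) ((ofX a).tangent g X) =
      a g * θ₁ g X := congr_fun₂ (pullback_ω₁ a) g X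
  have eω₂ (g X) : CoframeBundle.ω₂ θ θ₂ ((ofX a).toFun g) ((ofX a).tangent g X) =
      (a g : ℂ)⁻¹ * θ₂ g X := congr_fun₂ (pullback_ω₂ a) g X
  have eφ (g X) : CoframeBundle.φ θ θ₁ θ₂ ((ofX a).toFun g) ((ofX a).tangent g X) = 0 := by
    rw [tangent_ofX ha, φ_apply]
    simp [toFun, ofX]
  have eω₁₁ (g X) : C.ω₁₁ ((ofX a).toFun g) ((ofX a).tangent g X) =
      -η g X - 3 / 4 * x * θ g X := by
    rw [tangent_ofX ha, hη]
    simp only [C, ConnectionData.ofCoframe, frameForm_apply, toFun, ofX, Pi.zero_apply]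
    ring
  have eφ₁ (g X) : C.φ₁ ((ofX a).toFun g) ((ofX a).tangent g X) =
      a g * (x / 4 * θ₁ g X + y * θ₂ g X) := by
    rw [tangent_ofX ha]
    simp only [C, ConnectionData.ofCoframe, frameForm_apply, toFun, ofX, Pi.zero_apply,
      Units.val_inv_eq_inv_val, inv_inv]
    ring
  have eφ₂ (g X) : C.φ₂ ((ofX a).toFun g) ((ofX a).tangent g X) =
      (a g : ℂ)⁻¹ * (z * θ₁ g X - x / 4 * θ₂ g X) := by
    rw [tangent_ofX ha]
    simp only [C, ConnectionData.ofCoframe, frameForm_apply, toFun, ofX, Pi.zero_apply]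
    ring
  have eψ (g X) : C.ψ ((ofX a).toFun g) ((ofX a).tangent g X) =
      -(2 * y * z + x ^ 2 / 8) * θ g X := by
    rw [tangent_ofX ha]
    simp only [C, ConnectionData.ofCoframe, frameForm_apply, toFun, ofX, Pi.zero_apply,
      Units.val_inv_eq_inv_val, inv_inv, inv_mul_cancel₀ (a g).ne_zero]
    ring
  have hπ : (Real.pi : ℂ) ≠ 0 := Complex.ofReal_ne_zero.2 Real.pi_ne_zero
  funext g X Y Z
  have hne := (a g).ne_zero
  simp only [pullback₃, ConnectionData.chernSimons, ConnectionData.connectionForm,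
    Fin.sum_univ_three, Pi.smul_apply, Pi.add_apply, Pi.sub_apply, wedge3, wedge21, wedge,
    smul_eq_mul, Matrix.of_apply, Matrix.cons_val, LinearMap.sub_apply, LinearMap.smul_apply,
    LinearMap.neg_apply, Pi.neg_apply, eω, eω₁, eω₂, eφ, eω₁₁, eφ₁, eφ₂, eψ, C]
  field_simp
  ring

end CoframeSection

/-! ### Passage from the basis α, β, γ to the coframe γ, Z¹, Z². -/

/-- The coframe `γ, r₁ β + r₂ α, s₁ β + s₂ α`. -/
theorem isFlagCoframe_of_basis {α β γ : OneForm SU2 su2} (hα : IsLeftInvariant α)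
    (hβ : IsLeftInvariant β) (hγ : IsLeftInvariant γ)
    (dα : extD α = -wedge β γ) (dβ : extD β = -wedge γ α) (dγ : extD γ = -wedge α β)
    {r₁ r₂ s₁ s₂ : ℂ} (hdet : r₁ * s₂ - r₂ * s₁ = 1) :
    extD γ = wedge (r₁ • β + r₂ • α) (s₁ • β + s₂ • α) ∧
    IsFlagCoframe γ (r₁ • β + r₂ • α) (s₁ • β + s₂ • α)
      (r₁ * s₁ + r₂ * s₂) (-(r₁ ^ 2 + r₂ ^ 2)) (s₁ ^ 2 + s₂ ^ 2) := by
  have hinv (c d : ℂ) : IsLeftInvariant (c • β + d • α) := fun h g => by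
    simp only [Pi.add_apply, Pi.smul_apply, hα h g, hβ h g]
  have hd (c d : ℂ) (g X Y) : extD (c • β + d • α) g X Y =
      -(c * (γ g X * α g Y - γ g Y * α g X) + d * (β g X * γ g Y - β g Y * γ g X)) := by
    have e₁ := congr_fun₃ dα g X Y
    have e₂ := congr_fun₃ dβ g X Y
    simp only [hα.extD_apply, hβ.extD_apply, Pi.neg_apply, wedge] at e₁ e₂
    simp only [(hinv c d).extD_apply, Pi.add_apply, Pi.smul_apply, LinearMap.add_apply,
      LinearMap.smul_apply, smul_eq_mul]
    linear_combination c * e₂ + d * e₁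
  have hdγ : extD γ = wedge (r₁ • β + r₂ • α) (s₁ • β + s₂ • α) := by
    rw [dγ]
    funext g X Y
    simp only [wedge, Pi.neg_apply, Pi.add_apply, Pi.smul_apply, LinearMap.add_apply,
      LinearMap.smul_apply, smul_eq_mul]
    linear_combination (α g X * β g Y - α g Y * β g X) * hdet
  refine ⟨hdγ, isFlagCoframe_of_extD hγ (hinv _ _) (hinv _ _) hdγ (fun g X Y => ?_)
    fun g X Y => ?_⟩
  · rw [hd]
    simp only [Pi.add_apply, Pi.smul_apply, LinearMap.add_apply, LinearMap.smul_apply, smul_eq_mul]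
    -- Here dZ¹ = γ∧(r₂β − r₁α), and xZ¹ + yZ² is r₂β − r₁α times the determinant. Likewise zZ¹ −
    -- xZ² gives s₂β − s₁α in the second case.
    linear_combination (-(r₁ * (γ g X * α g Y - γ g Y * α g X))
      + r₂ * (γ g X * β g Y - γ g Y * β g X)) * -hdet
  · rw [hd]
    simp only [Pi.add_apply, Pi.smul_apply, LinearMap.add_apply, LinearMap.smul_apply, smul_eq_mul]
    linear_combination (-(s₁ * (γ g X * α g Y - γ g Y * α g X))
      + s₂ * (γ g X * β g Y - γ g Y * β g X)) * -hdet

/-- The change from β, α to Z¹, Z² has determinant 1, so Z¹∧Z² = β∧α. -/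
theorem wedge3_of_basis {α β : OneForm SU2 su2} {r₁ r₂ s₁ s₂ : ℂ}
    (hdet : r₁ * s₂ - r₂ * s₁ = 1) (η : OneForm SU2 su2) :
    wedge3 η (r₁ • β + r₂ • α) (s₁ • β + s₂ • α) = wedge3 η β α := by
  funext g X Y Z
  simp only [wedge3, wedge21, wedge, Pi.add_apply, Pi.smul_apply, LinearMap.add_apply,
    LinearMap.smul_apply, smul_eq_mul]
  linear_combination ((η g X * β g Y - η g Y * β g X) * α g Z
    - (η g X * β g Z - η g Z * β g X) * α g Y + (η g Y * β g Z - η g Z * β g Y) * α g X) * hdet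

end

theorem mainTheorem10
    (b : Module.Basis (Fin 3) ℝ realLeftInvariantForms)
    (α β γ : OneForm SU2 su2)
    (hα : α = b 0) (hβ : β = b 1) (hγ : γ = b 2)
    (dα : extD α = -wedge β γ) (dβ : extD β = -wedge γ α) (dγ : extD γ = -wedge α β)
    (r₁ r₂ s₁ s₂ : ℂ) (hdet : r₁ * s₂ - r₂ * s₁ = 1)
    (Z₁ Z₂ : OneForm SU2 su2)
    (hZ₁ : Z₁ = r₁ • β + r₂ • α) (hZ₂ : Z₂ = s₁ • β + s₂ • α)
    (x y z : ℂ)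
    (hx : x = r₁ * s₁ + r₂ * s₂) (hy : y = -(r₁ ^ 2 + r₂ ^ 2)) (hz : z = s₁ ^ 2 + s₂ ^ 2) :
    -- the flag structure
    IsFlagStructure (fun g => kerC (γ g) ⊓ kerC (Z₂ g)) (fun g => kerC (γ g) ⊓ kerC (Z₁ g)) ∧
    extD γ = wedge Z₁ Z₂ ∧
    -- the sections of `X` are the sections `σ` of `Y` with `σ*ω = γ` and `σ*φ = 0`
    (∀ σ : CoframeSection, σ.IsSmooth →
      ((σ.pullback₁ (CoframeBundle.ω γ) = fun g X => γ g X) ∧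
        σ.pullback₁ (CoframeBundle.φ γ Z₁ Z₂) = 0 ↔
          ∃ a : SU2 → ℂˣ, σ = CoframeSection.ofX a)) ∧
    (∀ a : SU2 → ℂˣ,
      ((CoframeSection.ofX a).pullback₁ (CoframeBundle.ω₁ γ Z₁) = fun g X => (a g : ℂ) * Z₁ g X) ∧
      ((CoframeSection.ofX a).pullback₁ (CoframeBundle.ω₂ γ Z₂) =
        fun g X => (a g : ℂ)⁻¹ * Z₂ g X)) ∧
    -- the adapted connection exists and is unique
    ∃ C : ConnectionData, C.IsAdapted γ Z₁ Z₂ ∧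
      (∀ C' : ConnectionData, C'.IsAdapted γ Z₁ Z₂ → C' = C) ∧
      -- the curvatures at the point `(g, a)` of `X`
      (∀ (g : SU2) (a : ℂˣ),
        C.Q₁ (embX g a) = -(3 / 2) * x * y * (a : ℂ) ^ 2 ∧
        C.Q₂ (embX g a) = (3 / 2) * x * z * ((a : ℂ) ^ 2)⁻¹) ∧
      -- the curvatures vanish, at one point of `Y` or identically, iff `x = 0` or `y = z = 0`
      (∀ p : CoframeBundle, (C.Q₁ p = 0 ∧ C.Q₂ p = 0) ↔ (x = 0 ∨ (y = 0 ∧ z = 0))) ∧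
      -- the Chern–Simons form, for the sections of `X` with constant `a`
      (∀ a : ℂˣ,
        (CoframeSection.ofX fun _ => a).pullback₃ (C.chernSimons γ Z₁ Z₂) =
          (-(1 / (8 * (Real.pi : ℂ) ^ 2)) * (2 * y * z + x ^ 2 / 2)) • wedge3 γ β α) ∧
      -- the Chern–Simons form, for an arbitrary smooth section of `X`
      (∀ (a : SU2 → ℂˣ), Smooth (fun g => (a g : ℂ)) →
        ∃ dlogA : OneForm SU2 su2, (∀ g X, dlogA g X = CoframeSection.dlog a g X) ∧
        (CoframeSection.ofX a).pullback₃ (C.chernSimons γ Z₁ Z₂) =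
          (-(1 / (8 * (Real.pi : ℂ) ^ 2)) * (2 * y * z + x ^ 2 / 2)) • wedge3 γ β α
          - (x / (16 * (Real.pi : ℂ) ^ 2)) • wedge3 dlogA β α) := by
  have hγ' : IsLeftInvariant γ := hγ ▸ (b 2).2.1
  obtain ⟨hdγ, hco⟩ := isFlagCoframe_of_basis (hα ▸ (b 0).2.1) (hβ ▸ (b 1).2.1) hγ' dα dβ dγ hdet
  have hw := wedge3_of_basis (α := α) (β := β) hdet
  rw [← hZ₁, ← hZ₂] at hdγ hw
  rw [← hZ₁, ← hZ₂, ← hx, ← hy, ← hz] at hco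
  obtain ⟨e, he⟩ := exists_dual_basis b
  have heα (j g) : α g (e j) = if 0 = j then 1 else 0 := by rw [hα, he]
  have heβ (j g) : β g (e j) = if 1 = j then 1 else 0 := by rw [hβ, he]
  have heγ (j g) : γ g (e j) = if 2 = j then 1 else 0 := by rw [hγ, he]
  -- The order `e 1`, `e 0` reflects that r₁, s₁ are the coefficients of β = `b 1` and r₂, s₂ those
  -- of α = `b 0`.
  have hf : IsAdaptedFrame γ Z₁ Z₂ r₁ r₂ s₁ s₂ (e 1) (e 0) (e 2) := by
    constructor
    · exact hdet
    all_goals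
      intro g
      simp [hZ₁, hZ₂, heα, heβ, heγ]
  refine ⟨hco.isFlagStructure e hf, hdγ,
    fun σ hσ => CoframeSection.pullback_ω_φ_iff ⟨_, _, _, hf⟩ hσ,
    fun a => ⟨CoframeSection.pullback_ω₁ a, CoframeSection.pullback_ω₂ a⟩,
    ConnectionData.ofCoframe γ Z₁ Z₂ x y z, ConnectionData.isAdapted_ofCoframe hco,
    fun C' hC' => (ConnectionData.isAdapted_ofCoframe hco).unique hco hf hC',
    fun g a => ⟨?_, ?_⟩, fun p => ?_, fun a => ?_, fun a ha => ?_⟩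
  · have := a.ne_zero
    simp only [ConnectionData.ofCoframe, embX, Units.val_inv_eq_inv_val, inv_inv]
    field_simp
  · have := a.ne_zero
    simp only [ConnectionData.ofCoframe, embX, Units.val_inv_eq_inv_val, inv_inv]
    field_simp
  -- The fibre factors are units, so the condition at any p is xy = 0 and xz = 0.
  · simp only [ConnectionData.ofCoframe, mul_eq_zero, neg_eq_zero, pow_eq_zero_iff, inv_eq_zero,
      Units.ne_zero, ne_eq, OfNat.ofNat_ne_zero, not_false_eq_true, or_false, div_eq_zero_iff,
      false_or]
    tauto
  · rw [CoframeSection.pullback_chernSimons (η := 0) (Smooth.const _)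
      (fun g X => (CoframeSection.dlog_const a g X).symm), hw]
    have h0 : wedge3 (0 : OneForm SU2 su2) Z₁ Z₂ = 0 := by
      funext g X Y Z
      simp [wedge3, wedge21, wedge]
    rw [h0, smul_zero, sub_zero]
  · obtain ⟨η, hη⟩ := CoframeSection.exists_dlogForm ha
    refine ⟨η, hη, ?_⟩
    rw [CoframeSection.pullback_chernSimons ha hη, hw, hw]
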